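/- Let $G=\widetilde{SL(2,\mathbb R)}$ be the universal cover of $SL(2,\mathbb R)$ with its bi-invariant Killing metric ($G=\mathrm{AdS}_3$), let $H=\mathrm{diag}(1,-1)\in\mathfrak g=\mathfrak{sl}(2,\mathbb R)$, $A=\exp(\mathbb R H)$, and let $N,\overline N$ be the upper and lower unipotent one-parameter subgroups of $G$. The groups $AN$ and $A\overline N$ are the neutral components of the two minimal parabolic subgroups of $G$ containing $A$. A generic BHTZ Killing field is $\Xi=(X,Y)\in\mathfrak g\oplus\mathfrak g$ with $X=\mathrm{Ad}(g)(mH)$, $Y=\mathrm{Ad}(h)(m'H)$, $g,h\in G$, $m,m'>0$; its flow is $\phi_t(x)=\exp(tX)\,x\,\exp(-tY)$, and $\mathbb Z$ acts on $G$ by $n\cdot x=\phi_n(x)$. It is spinless if $m=m'$ and rotating if $m\ne m'$. The isometry $\psi(y)=gyh^{-1}$ brings $\Xi$ into the normal form $(mH,m'H)$. In this normal form the associated action of $R\in\{AN,A\overline N\}$ is the following. * If $m=m'$: $\tau_r(x)=r\,x\,\sigma(r^{-1})$, where $\sigma$ is the involutive exterior automorphism of $G$ induced by conjugation by $\mathrm{diag}(1,-1)$;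 it fixes $A$ pointwise. * If $m'<m$: $an\cdot x=an\,x\,a^{\alpha}$ with $\alpha=-m'/m$, where $\exp(tH)^{\alpha}=\exp(\alpha tH)$. * If $m<m'$: $an\cdot x=a^{m/m'}\,x\,(an)^{-1}$, which is the previous case transported by $x\mapsto x^{-1}$. For general $\Xi$ the associated action is transported by $\psi$. A BHTZ domain is an open, connected, simply connected, $\mathbb Z$-stable subset $U\subset G$ that is maximal among such subsets for the two properties (i) $\mathbb Z$ acts properly and totally discontinuously on $U$, and (ii) $\Xi$ is everywhere spacelike on $U$ (of positive Killing norm). A BHTZ extension domain is an open, connected, simply connected, $\mathbb Z$-stable subset that is maximal among such subsets for property (i) alone. **Claim.** Let $\Xi$ be a generic BHTZ Killing field. 1. For every BHTZ domain $U$ and each of the two groups $R\in\{AN,A\overline N\}$, there is exactly one BHTZ extension domain $E\supseteq U$ that is foliated by the (two-dimensional) orbits of the associated action of $R$. 2. For a BHTZ domain $U$, any two extension domains $E,E'\supseteq U$ as in 1 (for the same or for different groups $R$) are conjugate: there is $j\in G$ such that $c_j=\psi\circ(y\mapsto jyj^{-1})\circ\psi^{-1}$ satisfies $c_j(U)=U$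 and $c_j(E)=E'$, and for some $\varepsilon\in\{1,-1\}$ one has $c_j(n\cdot x)=(\varepsilon n)\cdot c_j(x)$ for all $n\in\mathbb Z$, $x\in G$. 3. Suppose $m=m'$. Let $\mathcal O=\mathrm{Ad}(G)H\subset\mathfrak g$, and let $R=AN$, $\mathfrak n=\mathrm{Lie}(N)$ (or $R=A\overline N$, $\mathfrak n=\mathrm{Lie}(\overline N)$). Then $R$ has exactly two open orbits in $\mathcal O$ for the adjoint action. They are the connected components of $\mathcal O\setminus\mathfrak n^{\perp}$, where $\perp$ is taken with respect to the Killing form. On each of them $R$ acts with trivial stabilizers, and the $\mathbb Z$-action $n\mapsto\mathrm{Ad}(\exp(nmH))$ is proper and totally discontinuous. Moreover, for each open orbit $S$, every connected component of the subset $\psi(\{\tau_k(a): a\in A,\ k\in G,\ \mathrm{Ad}(k)H\in S\})$ of $G$ is a BHTZ extension domain foliated by the orbits of the associated action of $R$. -/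

import Mathlib

open Set Topology

/-- The universal covering group `G` of `SL(2, ℝ)`, i.e. the anti-de Sitter space `AdS₃`: an element
is a matrix `x = (a b; c d)` of `SL(2, ℝ)` together with a continuous logarithm of its automorphy
factor `τ ↦ c τ + d` on the upper half-plane. That this is the universal covering group is proved
below: `G` is a simply connected topological group and `proj : G → SL(2, ℝ)` is a covering
homomorphism. -/
@[ext]
structure SL2Cover where
  mat : Matrix.SpecialLinearGroup (Fin 2) ℝ
  log : C(UpperHalfPlane, ℂ)
  exp_log : ∀ τ : UpperHalfPlane,
    Complex.exp (log τ) = (mat 1 0 : ℂ) * (τ : ℂ) + (mat 1 1 : ℂ)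

namespace SL2Cover

theorem cocycle (x y : Matrix.SpecialLinearGroup (Fin 2) ℝ) (τ : UpperHalfPlane) :
    ((x * y) 1 0 : ℂ) * (τ : ℂ) + ((x * y) 1 1 : ℂ) =
      ((x 1 0 : ℂ) * ((y • τ : UpperHalfPlane) : ℂ) + (x 1 1 : ℂ)) *
        ((y 1 0 : ℂ) * (τ : ℂ) + (y 1 1 : ℂ)) := by
  have h : (y 1 0 : ℂ) * (τ : ℂ) + (y 1 1 : ℂ) ≠ 0 := UpperHalfPlane.denom_ne_zero y τ
  rw [UpperHalfPlane.coe_specialLinearGroup_apply]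
  simp only [Matrix.SpecialLinearGroup.coe_mul, Matrix.mul_apply, Fin.sum_univ_two,
    Algebra.algebraMap_self, RingHom.id_apply]
  push_cast
  field_simp
  ring

noncomputable instance : Mul SL2Cover where
  mul x y :=
    { mat := x.mat * y.mat
      log := ⟨fun τ => x.log (y.mat • τ) + y.log τ, by fun_prop⟩
      exp_log := fun τ => by
        simp only [ContinuousMap.coe_mk, Complex.exp_add, exp_log, cocycle] }

noncomputable instance : One SL2Cover where
  one :=
    { mat := 1
      log := ⟨fun _ => 0, by fun_prop⟩
      exp_log := fun τ => by simp }

noncomputable instance : Inv SL2Cover where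
  inv x :=
    { mat := x.mat⁻¹
      log := ⟨fun τ => -x.log (x.mat⁻¹ • τ), by fun_prop⟩
      exp_log := fun τ => by
        have h := cocycle x.mat x.mat⁻¹ τ
        simp only [mul_inv_cancel, ← exp_log x] at h
        simp only [ContinuousMap.coe_mk, Complex.exp_neg]
        rw [inv_eq_iff_eq_inv]
        refine eq_inv_of_mul_eq_one_left ?_
        rw [← h]; simp }

@[simp] theorem mul_mat (x y : SL2Cover) : (x * y).mat = x.mat * y.mat := rfl
@[simp] theorem one_mat : (1 : SL2Cover).mat = 1 := rfl
@[simp] theorem inv_mat (x : SL2Cover) : x⁻¹.mat = x.mat⁻¹ := rfl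
@[simp] theorem mul_log (x y : SL2Cover) (τ : UpperHalfPlane) :
    (x * y).log τ = x.log (y.mat • τ) + y.log τ := rfl
@[simp] theorem one_log (τ : UpperHalfPlane) : (1 : SL2Cover).log τ = 0 := rfl
@[simp] theorem inv_log (x : SL2Cover) (τ : UpperHalfPlane) :
    x⁻¹.log τ = -x.log (x.mat⁻¹ • τ) := rfl

noncomputable instance : Group SL2Cover where
  mul_assoc x y z := by
    refine SL2Cover.ext (mul_assoc _ _ _) (ContinuousMap.ext fun τ => ?_)
    simp [mul_smul, add_assoc]
  one_mul x := SL2Cover.ext (one_mul _) (ContinuousMap.ext fun τ => by simp)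
  mul_one x := SL2Cover.ext (mul_one _) (ContinuousMap.ext fun τ => by simp)
  inv_mul_cancel x := SL2Cover.ext (inv_mul_cancel _) (ContinuousMap.ext fun τ => by simp)

/-- The topology induced from `SL(2, ℝ) × ℂ` by `x ↦ (matrix of x, logarithm at i)`. -/
noncomputable instance : TopologicalSpace SL2Cover :=
  TopologicalSpace.induced (fun x => (x.mat, x.log UpperHalfPlane.I)) inferInstance

/-- The covering homomorphism `G → SL(2, ℝ)`. -/
noncomputable def proj : SL2Cover →* Matrix.SpecialLinearGroup (Fin 2) ℝ where
  toFun := mat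
  map_one' := rfl
  map_mul' _ _ := rfl

/-- The automorphy factor `c τ + d`. -/
noncomputable def den (x : Matrix.SpecialLinearGroup (Fin 2) ℝ) (τ : UpperHalfPlane) : ℂ :=
  (x 1 0 : ℂ) * (τ : ℂ) + (x 1 1 : ℂ)

theorem den_ne_zero (x : Matrix.SpecialLinearGroup (Fin 2) ℝ) (τ : UpperHalfPlane) :
    den x τ ≠ 0 := UpperHalfPlane.denom_ne_zero x τ

theorem den_ratio (x : Matrix.SpecialLinearGroup (Fin 2) ℝ) (τ τ' : UpperHalfPlane) :
    den x τ / den x τ' ∈ Complex.slitPlane := by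
  rw [Complex.mem_slitPlane_iff_not_le_zero]
  intro h
  obtain ⟨h1, h2⟩ := Complex.le_def.1 h
  set t := den x τ / den x τ' with ht
  have h3 : den x τ = t * den x τ' := by rw [ht, div_mul_cancel₀ _ (den_ne_zero x τ')]
  have h4 := congrArg Complex.im h3
  have h5 := congrArg Complex.re h3
  simp only [den, Complex.mul_im, Complex.mul_re, Complex.add_im, Complex.add_re,
    Complex.ofReal_re, Complex.ofReal_im, UpperHalfPlane.coe_im, UpperHalfPlane.coe_re] at h4 h5
  simp only [Complex.zero_re, Complex.zero_im] at h1 h2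
  rw [h2] at h4 h5
  have p1 := τ.im_pos
  have p2 := τ'.im_pos
  have c0 : x 1 0 = 0 := by
    have : x 1 0 * (τ.im - t.re * τ'.im) = 0 := by linarith
    rcases mul_eq_zero.1 this with h | h
    · exact h
    · nlinarith
  have d0 : x 1 1 ≠ 0 := by
    intro h
    apply den_ne_zero x τ
    simp [den, c0, h]
  rw [c0] at h5
  have : x 1 1 * (1 - t.re) = 0 := by linarith
  rcases mul_eq_zero.1 this with h | h
  · exact d0 h
  · linarith

theorem log_eq (x : SL2Cover) (τ τ' : UpperHalfPlane) :
    x.log τ = x.log τ' + Complex.log (den x.mat τ / den x.mat τ') := by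
  have h := Complex.isCoveringMap_exp.eq_of_comp_eq (A := UpperHalfPlane)
    (g₁ := fun τ => x.log τ)
    (g₂ := fun τ => x.log τ' + Complex.log (den x.mat τ / den x.mat τ'))
    (by fun_prop) ?_ ?_ τ' ?_
  · exact congrFun h τ
  · refine continuous_const.add (Continuous.clog ?_ fun τ => den_ratio _ _ _)
    unfold den
    fun_prop
  · funext τ
    apply Subtype.ext
    simp only [Function.comp, Complex.exp_add,
      Complex.exp_log (Complex.slitPlane_ne_zero (den_ratio x.mat τ τ')), exp_log]
    change den x.mat τ = den x.mat τ' * _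
    field_simp [den_ne_zero]
  · simp [div_self (den_ne_zero _ _)]

theorem continuous_mat : Continuous mat := by
  exact continuous_fst.comp (continuous_induced_dom (f := fun x : SL2Cover =>
    (x.mat, x.log UpperHalfPlane.I)))

theorem continuous_log_I : Continuous fun x : SL2Cover => x.log UpperHalfPlane.I := by
  exact continuous_snd.comp (continuous_induced_dom (f := fun x : SL2Cover =>
    (x.mat, x.log UpperHalfPlane.I)))

theorem continuous_den :
    Continuous fun p : Matrix.SpecialLinearGroup (Fin 2) ℝ × UpperHalfPlane => den p.1 p.2 := by
  unfold den
  fun_prop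

theorem continuous_log : Continuous fun p : SL2Cover × UpperHalfPlane => p.1.log p.2 := by
  have h : (fun p : SL2Cover × UpperHalfPlane => p.1.log p.2) = fun p =>
      p.1.log UpperHalfPlane.I +
        Complex.log (den p.1.mat p.2 / den p.1.mat UpperHalfPlane.I) := by
    funext p
    exact log_eq _ _ _
  rw [h]
  have h1 : Continuous fun p : SL2Cover × UpperHalfPlane => p.1.mat :=
    continuous_mat.comp continuous_fst
  refine Continuous.add (continuous_log_I.comp continuous_fst) ?_
  refine Continuous.clog ?_ fun p => den_ratio _ _ _
  refine Continuous.div ?_ ?_ fun p => den_ne_zero _ _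
  · exact continuous_den.comp (h1.prodMk continuous_snd)
  · exact continuous_den.comp (h1.prodMk continuous_const)

instance : IsTopologicalGroup SL2Cover where
  continuous_mul := by
    refine continuous_induced_rng.2 ?_
    have h1 : Continuous fun p : SL2Cover × SL2Cover => p.1.mat := continuous_mat.comp continuous_fst
    have h2 : Continuous fun p : SL2Cover × SL2Cover => p.2.mat := continuous_mat.comp continuous_snd
    refine (h1.mul h2).prodMk (Continuous.add ?_ ?_)
    · exact continuous_log.comp (continuous_fst.prodMk (h2.smul continuous_const))
    · exact continuous_log.comp (continuous_snd.prodMk continuous_const)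
  continuous_inv := by
    refine continuous_induced_rng.2 ?_
    refine continuous_mat.inv.prodMk (Continuous.neg ?_)
    exact continuous_log.comp (continuous_id.prodMk (continuous_mat.inv.smul continuous_const))


theorem ext_I {x y : SL2Cover} (h : x.mat = y.mat)
    (h' : x.log UpperHalfPlane.I = y.log UpperHalfPlane.I) : x = y := by
  refine SL2Cover.ext h (ContinuousMap.ext fun τ => ?_)
  rw [log_eq x τ UpperHalfPlane.I, log_eq y τ UpperHalfPlane.I, h, h']

/-- The element over `x` whose logarithm at `i` is `w`. -/
noncomputable def lift (x : Matrix.SpecialLinearGroup (Fin 2) ℝ) (w : ℂ)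
    (h : Complex.exp w = den x UpperHalfPlane.I) : SL2Cover where
  mat := x
  log := ⟨fun τ => w + Complex.log (den x τ / den x UpperHalfPlane.I), by
    refine continuous_const.add (Continuous.clog ?_ fun τ => den_ratio _ _ _)
    unfold den
    fun_prop⟩
  exp_log := fun τ => by
    have h0 := den_ne_zero x UpperHalfPlane.I
    simp only [ContinuousMap.coe_mk, Complex.exp_add, h,
      Complex.exp_log (Complex.slitPlane_ne_zero (den_ratio x τ UpperHalfPlane.I))]
    change _ = den x τ
    field_simp

@[simp] theorem lift_mat (x : Matrix.SpecialLinearGroup (Fin 2) ℝ) (w : ℂ)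
    (h : Complex.exp w = den x UpperHalfPlane.I) : (lift x w h).mat = x := rfl

@[simp] theorem lift_log (x : Matrix.SpecialLinearGroup (Fin 2) ℝ) (w : ℂ)
    (h : Complex.exp w = den x UpperHalfPlane.I) :
    (lift x w h).log UpperHalfPlane.I = w := by
  simp [lift, div_self (den_ne_zero _ _)]

theorem exp_log_I (x : SL2Cover) :
    Complex.exp (x.log UpperHalfPlane.I) = den x.mat UpperHalfPlane.I := x.exp_log _

theorem isOpenMap_mat : IsOpenMap mat := by
  refine IsOpenMap.of_sections fun x => ?_
  refine ⟨fun y => lift y (x.log UpperHalfPlane.I +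
    Complex.log (den y UpperHalfPlane.I / den x.mat UpperHalfPlane.I)) ?_, ?_, ?_, ?_⟩
  · rw [Complex.exp_add, exp_log_I, Complex.exp_log (div_ne_zero (den_ne_zero _ _)
      (den_ne_zero _ _))]
    field_simp [den_ne_zero x.mat UpperHalfPlane.I]
  · refine (Topology.IsInducing.mk rfl :
      Topology.IsInducing fun x : SL2Cover => (x.mat, x.log UpperHalfPlane.I)).continuousAt_iff.2 ?_
    have : Continuous fun y => den y UpperHalfPlane.I :=
      continuous_den.comp (continuous_id.prodMk continuous_const)
    refine ContinuousAt.prodMk continuousAt_id ?_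
    simp only [lift_log]
    refine continuousAt_const.add (ContinuousAt.clog ?_ ?_)
    · exact this.continuousAt.div_const _
    · rw [div_self (den_ne_zero _ _)]
      simp
  · exact ext_I rfl (by simp [div_self (den_ne_zero _ _)])
  · intro y
    rfl

theorem surjective_mat : Function.Surjective mat := fun x =>
  ⟨lift x _ (Complex.exp_log (den_ne_zero x UpperHalfPlane.I)), rfl⟩

theorem isCoveringMap_proj : IsCoveringMap proj := by
  refine (Topology.IsQuotientMap.isQuotientCoveringMap_of_isDiscrete_ker_monoidHom
    (f := proj) (isOpenMap_mat.isQuotientMap continuous_mat surjective_mat) ?_).isCoveringMap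
  suffices h : DiscreteTopology proj.ker from ⟨h⟩
  refine discreteTopology_of_isOpen_singleton_one ?_
  refine ⟨{x | ‖x.log UpperHalfPlane.I‖ < 1},
    isOpen_lt continuous_log_I.norm continuous_const, ?_⟩
  ext ⟨x, hx⟩
  have hx : x.mat = 1 := hx
  simp only [Set.mem_preimage, Set.mem_ofPred_eq, Set.mem_singleton_iff]
  rw [← Subtype.coe_inj]
  change _ ↔ x = 1
  constructor
  · intro h
    refine ext_I hx ?_
    have h1 := exp_log_I x
    rw [hx] at h1
    simp only [den, Matrix.SpecialLinearGroup.coe_one, Matrix.one_apply] at h1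
    norm_num at h1
    obtain ⟨n, hn⟩ := Complex.exp_eq_one_iff.1 h1
    rw [hn] at h ⊢
    simp only [norm_mul, Complex.norm_intCast, Complex.norm_ofNat, Complex.norm_I,
      Complex.norm_real, Real.norm_eq_abs, abs_of_pos Real.pi_pos] at h
    have hn0 : n = 0 := by
      by_contra h0
      have : (1 : ℝ) ≤ |(n : ℝ)| := by exact_mod_cast Int.one_le_abs h0
      nlinarith [Real.pi_gt_three]
    simp [hn0]
  · rintro rfl
    simp

theorem mat_ext {x y : Matrix.SpecialLinearGroup (Fin 2) ℝ}
    (h : x • UpperHalfPlane.I = y • UpperHalfPlane.I)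
    (h' : den x UpperHalfPlane.I = den y UpperHalfPlane.I) : x = y := by
  have h1 := congrArg (fun z : UpperHalfPlane => (z : ℂ)) h
  simp only [UpperHalfPlane.coe_specialLinearGroup_apply] at h1
  change _ / den x UpperHalfPlane.I = _ / den y UpperHalfPlane.I at h1
  rw [h', div_left_inj' (den_ne_zero _ _)] at h1
  simp only [den] at h'
  have a1 := congrArg Complex.re h1
  have a2 := congrArg Complex.im h1
  have a3 := congrArg Complex.re h'
  have a4 := congrArg Complex.im h'
  simp at a1 a2 a3 a4
  ext i j
  fin_cases i <;> fin_cases j <;> assumption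

/-- The rotation of angle `θ`. -/
noncomputable def rot (θ : ℝ) : Matrix.SpecialLinearGroup (Fin 2) ℝ :=
  ⟨!![Real.cos θ, -Real.sin θ; Real.sin θ, Real.cos θ], by
    simp [Matrix.det_fin_two, ← sq]⟩

theorem rot_smul_I (θ : ℝ) : rot θ • UpperHalfPlane.I = UpperHalfPlane.I := by
  ext
  rw [UpperHalfPlane.coe_specialLinearGroup_apply]
  change _ / den (rot θ) _ = _
  rw [div_eq_iff (den_ne_zero (rot θ) _)]
  simp only [den, rot, Algebra.algebraMap_self, RingHom.id_apply, UpperHalfPlane.coe_I,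
    Matrix.SpecialLinearGroup.coe_mk, Matrix.of_apply, Matrix.cons_val', Matrix.cons_val_zero,
    Matrix.cons_val_one, Matrix.cons_val_fin_one]
  push_cast
  linear_combination (-(Complex.sin θ)) * Complex.I_sq

theorem den_iwasawa (z : UpperHalfPlane) (θ : ℝ) :
    Complex.exp (((-(Real.log z.im) / 2 : ℝ) : ℂ) + θ * Complex.I) =
      den (z.toSL2R * rot θ) UpperHalfPlane.I := by
  have h := cocycle z.toSL2R (rot θ) UpperHalfPlane.I
  change den _ _ = _ at h
  rw [h, rot_smul_I, Complex.exp_add, Complex.exp_mul_I, ← Complex.ofReal_exp]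
  have : Real.exp (-(Real.log z.im) / 2) = 1 / √z.im := by
    rw [neg_div, Real.exp_neg, ← Real.log_sqrt z.im_pos.le, Real.exp_log (Real.sqrt_pos.2 z.im_pos)]
    simp
  rw [this]
  simp only [rot, UpperHalfPlane.coe_toSL2R, UpperHalfPlane.coe_I,
    Matrix.SpecialLinearGroup.coe_mk, Matrix.of_apply, Matrix.cons_val', Matrix.cons_val_zero,
    Matrix.cons_val_one, Matrix.cons_val_fin_one]
  push_cast
  ring

/-- Iwasawa coordinates. -/
noncomputable def homeo : SL2Cover ≃ₜ UpperHalfPlane × ℝ where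
  toFun x := (x.mat • UpperHalfPlane.I, (x.log UpperHalfPlane.I).im)
  invFun p := lift (p.1.toSL2R * rot p.2) _ (den_iwasawa p.1 p.2)
  left_inv x := by
    have hlog : (((-(Real.log (x.mat • UpperHalfPlane.I).im) / 2 : ℝ) : ℂ) +
        (x.log UpperHalfPlane.I).im * Complex.I) = x.log UpperHalfPlane.I := by
      apply Complex.ext
      · have h1 : (x.mat • UpperHalfPlane.I).im =
            (Real.exp (x.log UpperHalfPlane.I).re ^ 2)⁻¹ := by
          have h2 := UpperHalfPlane.im_smul_eq_div_normSq
            (x.mat : Matrix.GeneralLinearGroup (Fin 2) ℝ) UpperHalfPlane.I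
          change (x.mat • UpperHalfPlane.I).im = _ / Complex.normSq (den x.mat UpperHalfPlane.I) at h2
          rw [← Complex.norm_exp, exp_log_I, ← Complex.normSq_eq_norm_sq]
          simpa using h2
        simp [h1]
      · simp
    refine ext_I (mat_ext ?_ ?_) ?_
    · simp [mul_smul, rot_smul_I]
    · rw [← exp_log_I x, lift_mat, ← den_iwasawa, hlog]
    · rw [lift_log, hlog]
  right_inv p := by
    refine Prod.ext ?_ ?_
    · simp [mul_smul, rot_smul_I]
    · simp
  continuous_toFun := (continuous_mat.smul continuous_const).prodMk
    (Complex.continuous_im.comp continuous_log_I)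
  continuous_invFun := by
    refine continuous_induced_rng.2 (Continuous.prodMk ?_ ?_)
    · refine (UpperHalfPlane.continuous_toSL2R.comp continuous_fst).mul
        (Continuous.comp (g := rot) ?_ continuous_snd)
      refine continuous_induced_rng.2 ?_
      change Continuous fun θ : ℝ => !![Real.cos θ, -Real.sin θ; Real.sin θ, Real.cos θ]
      fun_prop
    · refine Continuous.congr (f := fun p : UpperHalfPlane × ℝ =>
        ((-(Real.log p.1.im) / 2 : ℝ) : ℂ) + p.2 * Complex.I) ?_ fun p => (lift_log _ _ _).symm
      have : Continuous fun p : UpperHalfPlane × ℝ => Real.log p.1.im :=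
        Continuous.log (by fun_prop) fun p => p.1.im_pos.ne'
      fun_prop

instance : SimplyConnectedSpace SL2Cover :=
  homeo.toHomotopyEquiv.simplyConnectedSpace



/-- The matrix `exp (t H) = diag (e ^ t, e ^ (-t))`. -/
noncomputable def cartanMat (t : ℝ) : Matrix.SpecialLinearGroup (Fin 2) ℝ :=
  ⟨!![Real.exp t, 0; 0, Real.exp (-t)], by simp [Matrix.det_fin_two, ← Real.exp_add]⟩

/-- The one-parameter subgroup `t ↦ exp (t H)` of the universal cover, `H = diag (1, -1)`. -/
noncomputable def cartan (t : ℝ) : SL2Cover where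
  mat := cartanMat t
  log := ⟨fun _ => ((-t : ℝ) : ℂ), continuous_const⟩
  exp_log := fun τ => by simp [cartanMat]

theorem cartan_add (s t : ℝ) : cartan (s + t) = cartan s * cartan t := by
  refine SL2Cover.ext (Subtype.ext ?_) (ContinuousMap.ext fun τ => ?_)
  · rw [mul_mat, Matrix.SpecialLinearGroup.coe_mul]
    simp [cartan, cartanMat, Real.exp_add, mul_comm]
  · simp [cartan]
    ring

/-- Conjugation of `SL(2, ℝ)` by `diag (1, -1)`, a matrix of determinant `-1`. -/
def sigmaMat (x : Matrix.SpecialLinearGroup (Fin 2) ℝ) : Matrix.SpecialLinearGroup (Fin 2) ℝ :=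
  ⟨!![x 0 0, -x 0 1; -x 1 0, x 1 1], by
    have h := x.det_coe
    rw [Matrix.det_fin_two] at h
    rw [Matrix.det_fin_two]
    simpa using h⟩

theorem sigmaMat_mul (x y : Matrix.SpecialLinearGroup (Fin 2) ℝ) :
    sigmaMat (x * y) = sigmaMat x * sigmaMat y := by
  apply Subtype.ext
  rw [Matrix.SpecialLinearGroup.coe_mul]
  ext i j
  fin_cases i <;> fin_cases j <;>
    simp [sigmaMat, Matrix.mul_apply, Fin.sum_univ_two] <;> ring

theorem smul_J (y : Matrix.SpecialLinearGroup (Fin 2) ℝ) (τ : UpperHalfPlane) :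
    y • UpperHalfPlane.J • τ = UpperHalfPlane.J • sigmaMat y • τ := by
  ext
  rw [UpperHalfPlane.coe_J_smul, UpperHalfPlane.coe_specialLinearGroup_apply,
    UpperHalfPlane.coe_specialLinearGroup_apply, UpperHalfPlane.coe_J_smul]
  simp only [map_div₀, map_add, map_mul, Complex.conj_ofReal, Algebra.algebraMap_self,
    RingHom.id_apply, sigmaMat, Matrix.SpecialLinearGroup.coe_mk, Matrix.of_apply,
    Matrix.cons_val', Matrix.cons_val_zero, Matrix.cons_val_one, Matrix.cons_val_fin_one,
    ← neg_div]
  push_cast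
  congr 1 <;> ring

/-- The exterior automorphism `σ` of `G` induced by conjugation by `diag (1, -1)`; it is involutive
(`sigma_sigma`) and fixes the Cartan subgroup `A = {cartan t}` pointwise (`sigma_cartan`). -/
noncomputable def sigma : SL2Cover →* SL2Cover where
  toFun x :=
    { mat := sigmaMat x.mat
      log := ⟨fun τ => (starRingEnd ℂ) (x.log (UpperHalfPlane.J • τ)), by fun_prop⟩
      exp_log := fun τ => by
        rw [ContinuousMap.coe_mk, Complex.exp_conj, exp_log, UpperHalfPlane.coe_J_smul]
        simp [sigmaMat] }
  map_one' := by
    refine SL2Cover.ext (Subtype.ext ?_) (ContinuousMap.ext fun τ => ?_)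
    · simp [sigmaMat, Matrix.one_fin_two]
    · simp
  map_mul' x y := by
    refine SL2Cover.ext (sigmaMat_mul _ _) (ContinuousMap.ext fun τ => ?_)
    simp [smul_J]

theorem continuous_sigma : Continuous sigma := by
  refine continuous_induced_rng.2 (Continuous.prodMk ?_ ?_)
  · refine continuous_induced_rng.2 ?_
    change Continuous fun x : SL2Cover =>
      !![x.mat 0 0, -x.mat 0 1; -x.mat 1 0, x.mat 1 1]
    have := continuous_mat
    fun_prop
  · exact Complex.continuous_conj.comp
      (continuous_log.comp (continuous_id.prodMk continuous_const))

theorem sigma_sigma (x : SL2Cover) : sigma (sigma x) = x := by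
  refine SL2Cover.ext (Subtype.ext ?_) (ContinuousMap.ext fun τ => ?_)
  · ext i j
    fin_cases i <;> fin_cases j <;> simp [sigma, sigmaMat]
  · have : UpperHalfPlane.J • UpperHalfPlane.J • τ = τ := by
      ext
      simp [UpperHalfPlane.coe_J_smul]
    simp [sigma, this]

theorem sigma_cartan (t : ℝ) : sigma (cartan t) = cartan t := by
  refine SL2Cover.ext (Subtype.ext ?_) (ContinuousMap.ext fun τ => ?_)
  · ext i j
    fin_cases i <;> fin_cases j <;> simp [sigma, sigmaMat, cartan, cartanMat]
  · simp [sigma, cartan]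

end SL2Cover

/-- The coordinates `(u, v, w)` of the traceless matrix `(u v; w -u)`. -/
noncomputable def sl2Coord : LieAlgebra.SpecialLinear.sl (Fin 2) ℝ ≃ₗ[ℝ] (Fin 3 → ℝ) where
  toFun X := ![X.1 0 0, X.1 0 1, X.1 1 0]
  map_add' X Y := by ext i; fin_cases i <;> simp
  map_smul' r X := by ext i; fin_cases i <;> simp
  invFun v := ⟨!![v 0, v 1; v 2, -v 0], by
    change Matrix.trace (!![v 0, v 1; v 2, -v 0] : Matrix (Fin 2) (Fin 2) ℝ) = 0
    simp [Matrix.trace_fin_two]⟩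
  left_inv X := by
    have h : X.1 0 0 + X.1 1 1 = 0 := by
      have h : Matrix.trace X.1 = 0 := X.2
      rwa [Matrix.trace_fin_two] at h
    apply Subtype.ext
    ext i j
    fin_cases i <;> fin_cases j <;> simp
    linarith
  right_inv v := by ext i; fin_cases i <;> simp

theorem killingForm_sl2 (X Y : LieAlgebra.SpecialLinear.sl (Fin 2) ℝ) :
    killingForm ℝ (LieAlgebra.SpecialLinear.sl (Fin 2) ℝ) X Y =
      4 * ((X : Matrix (Fin 2) (Fin 2) ℝ) * (Y : Matrix (Fin 2) (Fin 2) ℝ)).trace := by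
  have tr0 : ∀ X : LieAlgebra.SpecialLinear.sl (Fin 2) ℝ, X.1 1 1 = - X.1 0 0 := by
    intro X
    have h : Matrix.trace X.1 = 0 := X.2
    rw [Matrix.trace_fin_two] at h
    linarith
  have hX := tr0 X
  have hY := tr0 Y
  rw [killingForm_apply_apply,
    LinearMap.trace_eq_matrix_trace ℝ (Module.Basis.ofEquivFun sl2Coord)]
  simp only [Matrix.trace, Matrix.diag, Fin.sum_univ_three, LinearMap.toMatrix_apply,
    LinearMap.comp_apply, LieAlgebra.ad_apply, Module.Basis.ofEquivFun_repr_apply,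
    Module.Basis.coe_ofEquivFun]
  simp [-LieSubalgebra.coe_bracket, sl2Coord, LieAlgebra.SpecialLinear.sl_bracket, Matrix.mul_apply, Fin.sum_univ_two, hX, hY,
    Matrix.vecMul, dotProduct]
  ring

namespace BHTZ

/-- The trace form `4 tr (X Y)`, which is the Killing form of `sl(2, ℝ)`
(see `killingForm_sl2`). -/
def killing (X Y : Matrix (Fin 2) (Fin 2) ℝ) : ℝ := 4 * (X * Y).trace

/-- The generator `H = diag (1, -1)` of the split Cartan subalgebra. -/
def H : Matrix (Fin 2) (Fin 2) ℝ := !![1, 0; 0, -1]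

/-- The adjoint action of `G` on `sl(2, ℝ)`. -/
noncomputable def Ad (x : SL2Cover) (X : Matrix (Fin 2) (Fin 2) ℝ) :
    Matrix (Fin 2) (Fin 2) ℝ :=
  (x.mat : Matrix (Fin 2) (Fin 2) ℝ) * X * (x⁻¹.mat : Matrix (Fin 2) (Fin 2) ℝ)

/-- A generic BHTZ Killing field `Ξ = (X, Y) ∈ g ⊕ g`, given by
`X = Ad(g) (m H)` and `Y = Ad(h) (m' H)` with `m, m' > 0`. These are exactly the `Ξ` whose adjoint
orbit meets the split Cartan subalgebra `ℝ H ⊕ ℝ H` and whose two components have positive Killing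
norms (`8 m ^ 2` and `8 m' ^ 2`). The pair `(g, h)` records the isometry `y ↦ g y h⁻¹` of `AdS₃`
which brings `Ξ` into the normal form `(m H, m' H)`. The spinless case is `m = m'`, the rotating
case is `m ≠ m'`. -/
structure KillingDatum where
  m : ℝ
  m' : ℝ
  g : SL2Cover
  h : SL2Cover
  m_pos : 0 < m
  m'_pos : 0 < m'

namespace KillingDatum

variable (D : KillingDatum)

/-- The isometry `y ↦ g y h⁻¹`. -/
noncomputable def fromNormal (y : SL2Cover) : SL2Cover := D.g * y * D.h⁻¹

/-- The inverse isometry `x ↦ g⁻¹ x h`. -/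
noncomputable def toNormal (x : SL2Cover) : SL2Cover := D.g⁻¹ * x * D.h

/-- The flow `x ↦ exp (t X) x exp (-t Y)` of `Ξ`, where
`exp (t X) = g exp (m t H) g⁻¹` and `exp (t Y) = h exp (m' t H) h⁻¹`. -/
noncomputable def flow (t : ℝ) (x : SL2Cover) : SL2Cover :=
  D.g * SL2Cover.cartan (D.m * t) * D.g⁻¹ * x * (D.h * SL2Cover.cartan (-(D.m' * t)) * D.h⁻¹)

/-- The action of `ℤ` by the flow of `Ξ` at integer times. -/
noncomputable def zAct (n : ℤ) (x : SL2Cover) : SL2Cover := D.flow n x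

/-- The vector `X - Ad(x) Y` of `sl(2, ℝ)`, the right translate to the identity of the
value `X x - x Y` of `Ξ` at `x`. -/
noncomputable def killingVector (x : SL2Cover) : Matrix (Fin 2) (Fin 2) ℝ :=
  Ad D.g (D.m • H) - Ad x (Ad D.h (D.m' • H))

end KillingDatum

/-- The `ℤ`-action `f` is proper and totally discontinuous on `U`. -/
def ActsProperlyDiscontinuously {X : Type*} [TopologicalSpace X] (f : ℤ → X → X) (U : Set X) :
    Prop :=
  (∀ K ⊆ U, IsCompact K → {n : ℤ | (f n '' K ∩ K).Nonempty}.Finite) ∧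
  ∀ x ∈ U, ∃ V ∈ 𝓝[U] x, ∀ n : ℤ, n ≠ 0 → Disjoint (f n '' V) V

/-- `U` is open, connected, simply connected and `ℤ`-stable, and the restricted action is
proper and totally discontinuous. -/
structure IsAdmissible (D : KillingDatum) (U : Set SL2Cover) : Prop where
  isOpen : IsOpen U
  simplyConnected : IsSimplyConnected U
  stable : ∀ n : ℤ, ∀ x ∈ U, D.zAct n x ∈ U
  proper : ActsProperlyDiscontinuously D.zAct U

/-- A BHTZ domain: maximal among the admissible sets on which `Ξ` is everywhere spacelike, i.e. of
positive norm for the bi-invariant Lorentzian metric of `G` given by the Killing form. -/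
def IsBHTZDomain (D : KillingDatum) (U : Set SL2Cover) : Prop :=
  Maximal (fun U => IsAdmissible D U ∧
    ∀ x ∈ U, 0 < killing (D.killingVector x) (D.killingVector x)) U

/-- A BHTZ extension domain: maximal among the admissible sets. -/
def IsExtensionDomain (D : KillingDatum) (E : Set SL2Cover) : Prop :=
  Maximal (IsAdmissible D) E

/-- The two minimal parabolic subgroups of `G` containing `A`: the preimages of the groups of
upper triangular (`b = true`) and lower triangular (`b = false`) matrices. -/
def parabolic (b : Bool) : Subgroup SL2Cover where
  carrier := {x | if b then x.mat 1 0 = 0 else x.mat 0 1 = 0}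
  one_mem' := by cases b <;> simp
  mul_mem' := by
    intro x y hx hy
    cases b <;> simp_all [Matrix.mul_apply, Fin.sum_univ_two]
  inv_mem' := by
    intro x hx
    cases b <;> simp_all [Matrix.SpecialLinearGroup.SL2_inv_expl]

/-- The neutral component of a minimal parabolic subgroup, i.e. `AN` for `b = true` and `AN̄` for
`b = false`. -/
noncomputable def neutral (b : Bool) : Subgroup SL2Cover :=
  (Subgroup.connectedComponentOfOne (parabolic b)).map (parabolic b).subtype

/-- The twisted conjugation `τ_k (x) = k x σ(k⁻¹)`. -/
noncomputable def tau (k x : SL2Cover) : SL2Cover := k * x * SL2Cover.sigma k⁻¹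

/-- The coordinate `t` of the component `a = cartan t` of `r = a n` in `AN` or `AN̄`. -/
noncomputable def logA (r : SL2Cover) : ℝ := Real.log |r.mat 0 0|

/-- The action associated to `Ξ`, restricted to the neutral components of the minimal parabolic
subgroups. In the normal form of `Ξ` it is the twisted conjugation `x ↦ r x σ(r⁻¹)` in the spinless
case and, for `r = a n`, the action `x ↦ a n x a ^ α` with `α = -m' / m`, `|α| < 1`, in the
rotating case `m' < m`. The rotating case `m < m'` reduces to the latter by the
isometry `x ↦ x⁻¹`. -/
noncomputable def act (D : KillingDatum) (r x : SL2Cover) : SL2Cover :=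
  if D.m = D.m' then
    D.fromNormal (tau r (D.toNormal x))
  else if D.m' < D.m then
    D.fromNormal (r * D.toNormal x * SL2Cover.cartan (-(D.m' / D.m) * logA r))
  else
    D.fromNormal (SL2Cover.cartan (D.m / D.m' * logA r) * D.toNormal x * r⁻¹)

/-- `E` is foliated by the (two-dimensional) orbits of the associated action restricted to the
neutral component of a minimal parabolic subgroup: `E` is a union of orbits, and each point `x`
of `E` has a flow box `V × ℝ`, with `V` a neighbourhood of the identity in the acting group, whose
plaques `V · s(u)` lie in the orbits. -/
def FoliatedByOrbits (D : KillingDatum) (b : Bool) (E : Set SL2Cover) : Prop :=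
  (∀ r ∈ neutral b, ∀ x ∈ E, act D r x ∈ E) ∧
  ∀ x ∈ E, ∃ (V : Set (neutral b)) (s : ℝ → SL2Cover),
    IsOpen V ∧ 1 ∈ V ∧ s 0 = x ∧ (∀ u, s u ∈ E) ∧
    IsOpenEmbedding fun p : V × ℝ => act D ((p.1 : neutral b) : SL2Cover) (s p.2)

/-- Conjugation by `j`, in the coordinates that bring `Ξ` into normal form. -/
noncomputable def conjugation (D : KillingDatum) (j x : SL2Cover) : SL2Cover :=
  D.fromNormal (j * D.toNormal x * j⁻¹)

/-- `E` and `E'` are conjugate: a conjugation which normalizes the `ℤ`-action and preserves `U`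
maps `E` onto `E'`. -/
def ConjugateOver (D : KillingDatum) (U E E' : Set SL2Cover) : Prop :=
  ∃ j : SL2Cover,
    (∃ ε : ℤˣ, ∀ (n : ℤ) (x : SL2Cover),
      conjugation D j (D.zAct n x) = D.zAct (ε * n) (conjugation D j x)) ∧
    conjugation D j '' U = U ∧ conjugation D j '' E = E'

/-- The adjoint orbit of `H`. -/
def adjointOrbit : Set (Matrix (Fin 2) (Fin 2) ℝ) := range fun x : SL2Cover => Ad x H

/-- The orbits of `AN` (resp. `AN̄`) in the adjoint orbit of `H` that are open in it. -/
def openOrbits (b : Bool) : Set (Set (Matrix (Fin 2) (Fin 2) ℝ)) :=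
  {S | (∃ ξ ∈ adjointOrbit, S = {η | ∃ r ∈ neutral b, η = Ad r ξ}) ∧
    ∃ V : Set (Matrix (Fin 2) (Fin 2) ℝ), IsOpen V ∧ S = V ∩ adjointOrbit}

/-- The complement in the adjoint orbit of `H` of the Killing orthogonal of the Lie algebra of
`N` (resp. `N̄`). -/
def complementNilPerp (b : Bool) : Set (Matrix (Fin 2) (Fin 2) ℝ) :=
  {ξ ∈ adjointOrbit | killing (if b then !![0, 1; 0, 0] else !![0, 0; 1, 0]) ξ ≠ 0}

/-- The preimage of a subset `S` of the adjoint orbit of `H` under `τ_k (a) ↦ Ad(k) H`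
(`a ∈ A`, `k ∈ G`), in the spinless case. -/
def orbitPreimage (D : KillingDatum) (S : Set (Matrix (Fin 2) (Fin 2) ℝ)) : Set SL2Cover :=
  {x | ∃ (t : ℝ) (k : SL2Cover), x = D.fromNormal (tau k (SL2Cover.cartan t)) ∧ Ad k H ∈ S}

end BHTZ

/-! ### Matrix entries and the standard elements of the cover. -/

namespace SL2Cover

/-! Everything is transported by `adapted D b` to the normal form `(m H, m' H)` with the group `AN`.
For `b = false` this includes conjugation by a lift `weyl` of the Weyl element: it exchanges `AN`
and `AN̄`, inverts `A`, hence reverses the time of the flow, and is compatible with the associated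
action.

Write `x = (a b; c d)`. At time `n` the flow multiplies `a`, `b`, `c`, `d` by the exponentials of
`(m - m') n`, `(m + m') n`, `-(m + m') n`, `-(m - m') n`, and the Killing norm of `Ξ` at `x` is `8
(m - m')² - 32 m m' b c`.

Spinless case. The set `c ≠ 0` in `G` splits into sheets, indexed by `j` and cut out by the argument
`theta` of the automorphy factor at `i`; each is a Bruhat cell `centerGen ^ j N w A N`, a copy of
`ℝ³`. On a sheet `log |c|` is displaced by `(m + m') |n|`, so the action is proper there. Spacelike
means `b c < 0`, which forces `c ≠ 0`; so a BHTZ domain is one of the sets `wedge j`. A sheet is a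
maximal admissible set because a connected set leaving it contains a boundary point `z` in
`centerGen ^ k A N`, and sequences of orbits approach both `z` and a point of the sheet, which
contradicts properness (`isExtensionDomain_sheet`). Conversely, points with `c = 0` have stabilizers
of positive dimension under twisted conjugation, so a foliated set avoids them
(`FoliatedByOrbits.entry_10_ne_zero`). Hence the only foliated extension domain containing `wedge j`
is `sheet j`. The point `centerGen ^ j * weyl` of `wedge j` commutes with `weyl`, so the index `j`
is the same for both groups, and conjugation by `weyl` or its inverse exchanges the two extension
domains.

Rotating case. The top row (if `m' < m`) is expanded by every positive time, so the action is proper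
on all of `G`, and `G` is the only extension domain; it is foliated because the drift along `A`
never vanishes. The case `m < m'` follows by inversion.

Adjoint orbit. The lower left entry of `ξ` is a linear form with kernel orthogonal to `Lie N`, and
`AN` acts simply transitively on each of the two parts of the orbit of `H` where it has a given
sign. The entry `c` of `τ_k (a)` with `a = cartan t` is `cosh t` times this form at `Ad k H`, so the
preimage of an open orbit is a union of sheets. -/

theorem mul_entry (x y : SL2Cover) (i j : Fin 2) :
    (x * y).mat i j = x.mat i 0 * y.mat 0 j + x.mat i 1 * y.mat 1 j := by
  rw [mul_mat, Matrix.SpecialLinearGroup.coe_mul, Matrix.mul_apply, Fin.sum_univ_two]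

theorem inv_entries (x : SL2Cover) :
    x⁻¹.mat 0 0 = x.mat 1 1 ∧ x⁻¹.mat 0 1 = -x.mat 0 1 ∧ x⁻¹.mat 1 0 = -x.mat 1 0 ∧
      x⁻¹.mat 1 1 = x.mat 0 0 := by
  simp [Matrix.SpecialLinearGroup.SL2_inv_expl]

@[simp] theorem inv_entry_00 (x : SL2Cover) : x.mat⁻¹ 0 0 = x.mat 1 1 := (inv_entries x).1
@[simp] theorem inv_entry_01 (x : SL2Cover) : x.mat⁻¹ 0 1 = -x.mat 0 1 := (inv_entries x).2.1
@[simp] theorem inv_entry_10 (x : SL2Cover) : x.mat⁻¹ 1 0 = -x.mat 1 0 := (inv_entries x).2.2.1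
@[simp] theorem inv_entry_11 (x : SL2Cover) : x.mat⁻¹ 1 1 = x.mat 0 0 := (inv_entries x).2.2.2

theorem det_entries (x : SL2Cover) :
    x.mat 0 0 * x.mat 1 1 - x.mat 0 1 * x.mat 1 0 = 1 := by
  have h := x.mat.det_coe
  rwa [Matrix.det_fin_two] at h

theorem mat_eq_of_entries {x y : Matrix.SpecialLinearGroup (Fin 2) ℝ} (h00 : x 0 0 = y 0 0)
    (h01 : x 0 1 = y 0 1) (h10 : x 1 0 = y 1 0) (h11 : x 1 1 = y 1 1) : x = y := by
  ext i j
  fin_cases i <;> fin_cases j <;> assumption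

theorem continuous_entry (i j : Fin 2) : Continuous fun x : SL2Cover => x.mat i j := by
  have := continuous_mat
  fun_prop

/-- The upper unipotent one-parameter subgroup. -/
noncomputable def unip (q : ℝ) : SL2Cover where
  mat := ⟨!![1, q; 0, 1], by simp⟩
  log := ⟨fun _ => 0, continuous_const⟩
  exp_log := fun τ => by simp

/-- The lift of the rotation of angle `π / 2`. -/
noncomputable def weyl : SL2Cover where
  mat := ⟨!![0, -1; 1, 0], by simp⟩
  log := ⟨fun τ => Complex.log τ, by
    refine Continuous.clog (by fun_prop) fun τ => Or.inr ?_
    exact τ.im_pos.ne'⟩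
  exp_log := fun τ => by simp [Complex.exp_log τ.ne_zero]

/-- The lift of the rotation of angle `π`, a generator of the centre. -/
noncomputable def centerGen : SL2Cover where
  mat := -1
  log := ⟨fun _ => Real.pi * Complex.I, continuous_const⟩
  exp_log := fun τ => by simp

@[simp] theorem unip_00 (q : ℝ) : (unip q).mat 0 0 = 1 := by simp [unip]
@[simp] theorem unip_01 (q : ℝ) : (unip q).mat 0 1 = q := by simp [unip]
@[simp] theorem unip_10 (q : ℝ) : (unip q).mat 1 0 = 0 := by simp [unip]
@[simp] theorem unip_11 (q : ℝ) : (unip q).mat 1 1 = 1 := by simp [unip]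
@[simp] theorem unip_log (q : ℝ) (τ : UpperHalfPlane) : (unip q).log τ = 0 := rfl
@[simp] theorem weyl_00 : weyl.mat 0 0 = 0 := by simp [weyl]
@[simp] theorem weyl_01 : weyl.mat 0 1 = -1 := by simp [weyl]
@[simp] theorem weyl_10 : weyl.mat 1 0 = 1 := by simp [weyl]
@[simp] theorem weyl_11 : weyl.mat 1 1 = 0 := by simp [weyl]
@[simp] theorem weyl_log (τ : UpperHalfPlane) : weyl.log τ = Complex.log τ := rfl
@[simp] theorem center_mat : centerGen.mat = -1 := rfl
@[simp] theorem center_log (τ : UpperHalfPlane) : centerGen.log τ = Real.pi * Complex.I := rfl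
@[simp] theorem cartan_00 (t : ℝ) : (cartan t).mat 0 0 = Real.exp t := by simp [cartan, cartanMat]
@[simp] theorem cartan_01 (t : ℝ) : (cartan t).mat 0 1 = 0 := by simp [cartan, cartanMat]
@[simp] theorem cartan_10 (t : ℝ) : (cartan t).mat 1 0 = 0 := by simp [cartan, cartanMat]
@[simp] theorem cartan_11 (t : ℝ) : (cartan t).mat 1 1 = Real.exp (-t) := by
  simp [cartan, cartanMat]
@[simp] theorem cartan_log (t : ℝ) (τ : UpperHalfPlane) : (cartan t).log τ = ((-t : ℝ) : ℂ) := rfl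
@[simp] theorem sigma_log (x : SL2Cover) (τ : UpperHalfPlane) :
    (sigma x).log τ = (starRingEnd ℂ) (x.log (UpperHalfPlane.J • τ)) := rfl
@[simp] theorem sigma_00 (x : SL2Cover) : (sigma x).mat 0 0 = x.mat 0 0 := by simp [sigma, sigmaMat]
@[simp] theorem sigma_01 (x : SL2Cover) : (sigma x).mat 0 1 = -x.mat 0 1 := by
  simp [sigma, sigmaMat]
@[simp] theorem sigma_10 (x : SL2Cover) : (sigma x).mat 1 0 = -x.mat 1 0 := by
  simp [sigma, sigmaMat]
@[simp] theorem sigma_11 (x : SL2Cover) : (sigma x).mat 1 1 = x.mat 1 1 := by simp [sigma, sigmaMat]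

@[simp] theorem cartan_zero : cartan 0 = 1 := by
  have h := cartan_add 0 0
  simpa using h

theorem cartan_neg (t : ℝ) : cartan (-t) = (cartan t)⁻¹ := by
  rw [eq_inv_iff_mul_eq_one, ← cartan_add]
  simp

theorem unip_add (p q : ℝ) : unip (p + q) = unip p * unip q := by
  refine ext_I (mat_eq_of_entries ?_ ?_ ?_ ?_) (by simp) <;> rw [mul_entry] <;> simp [add_comm]

@[simp] theorem unip_zero : unip 0 = 1 := by
  have h := unip_add 0 0
  simpa using h

theorem unip_neg (t : ℝ) : unip (-t) = (unip t)⁻¹ := by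
  rw [eq_inv_iff_mul_eq_one, ← unip_add]
  simp

theorem cartan_mul_unip (t q : ℝ) :
    cartan t * unip q = unip (Real.exp (2 * t) * q) * cartan t := by
  refine ext_I (mat_eq_of_entries ?_ ?_ ?_ ?_) (by simp) <;> rw [mul_entry, mul_entry] <;> simp
  rw [mul_right_comm, ← Real.exp_add]
  ring_nf

theorem coe_cartan_smul (t : ℝ) (τ : UpperHalfPlane) :
    (((cartan t).mat • τ : UpperHalfPlane) : ℂ) = (Real.exp (2 * t) : ℝ) * (τ : ℂ) := by
  rw [UpperHalfPlane.coe_specialLinearGroup_apply]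
  simp only [cartan_00, cartan_01, cartan_10, cartan_11, Algebra.algebraMap_self, RingHom.id_apply]
  rw [two_mul, Real.exp_add, Real.exp_neg]
  have := Real.exp_ne_zero t
  push_cast
  field_simp
  simp

/-- No central factor appears in the cover: `cartan t` acts on the half-plane by a positive
dilation, which changes the principal logarithm carried by `weyl` by a real constant. -/
theorem cartan_mul_weyl (t : ℝ) : cartan t * weyl = weyl * cartan (-t) := by
  refine ext_I (mat_eq_of_entries ?_ ?_ ?_ ?_) ?_
  any_goals rw [mul_entry, mul_entry]; simp
  simp only [mul_log, weyl_log, cartan_log, coe_cartan_smul]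
  rw [Complex.log_ofReal_mul (Real.exp_pos _) (UpperHalfPlane.ne_zero _), Real.log_exp]
  push_cast
  ring

theorem weyl_mul_weyl : weyl * weyl = centerGen := by
  refine ext_I (mat_eq_of_entries ?_ ?_ ?_ ?_) ?_
  any_goals rw [mul_entry]; simp
  have h : weyl.mat • UpperHalfPlane.I = UpperHalfPlane.I := by
    ext
    rw [UpperHalfPlane.coe_specialLinearGroup_apply]
    simp
  simp [h, Complex.log_I]
  ring

theorem neg_one_smul_upperHalfPlane (τ : UpperHalfPlane) :
    (-1 : Matrix.SpecialLinearGroup (Fin 2) ℝ) • τ = τ := by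
  ext
  rw [UpperHalfPlane.coe_specialLinearGroup_apply]
  simp

theorem commute_center (x : SL2Cover) : Commute centerGen x := by
  refine ext_I ?_ ?_
  · simp
  · simp [add_comm, neg_one_smul_upperHalfPlane]

theorem commute_center_zpow (j : ℤ) (x : SL2Cover) : Commute (centerGen ^ j) x :=
  (commute_center x).zpow_left j

theorem J_smul_I : UpperHalfPlane.J • UpperHalfPlane.I = UpperHalfPlane.I := by
  ext
  rw [UpperHalfPlane.coe_J_smul]
  simp

theorem sigma_weyl : sigma weyl = weyl⁻¹ := by
  rw [eq_inv_iff_mul_eq_one]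
  have h : weyl.mat • UpperHalfPlane.I = UpperHalfPlane.I := by
    ext
    rw [UpperHalfPlane.coe_specialLinearGroup_apply]
    simp
  refine ext_I (mat_eq_of_entries ?_ ?_ ?_ ?_) ?_
  any_goals rw [mul_entry]; simp
  simp [h, J_smul_I, Complex.log_I, Complex.conj_ofNat]

/-- Conjugation by a matrix of determinant `-1` reverses rotations. Consequently replacing `k` by
`centerGen ^ i * k` multiplies `τ_k (x)` by `centerGen ^ (2 * i)`, although the centre acts
trivially under `Ad`. -/
theorem sigma_center : sigma centerGen = centerGen⁻¹ := by
  rw [← weyl_mul_weyl, map_mul, sigma_weyl, mul_inv_rev]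

theorem sigma_center_zpow (j : ℤ) : sigma (centerGen ^ j) = (centerGen ^ j)⁻¹ := by
  rw [map_zpow, sigma_center, inv_zpow]

theorem sigma_unip (q : ℝ) : sigma (unip q) = unip (-q) := by
  refine ext_I (mat_eq_of_entries ?_ ?_ ?_ ?_) ?_ <;> simp

/-- The argument of the automorphy factor at `i`. -/
noncomputable def theta (x : SL2Cover) : ℝ := (x.log UpperHalfPlane.I).im

/-! ### The argument of the automorphy factor and the fibres of the covering. -/

theorem continuous_theta : Continuous theta := Complex.continuous_im.comp continuous_log_I

theorem entry_10_eq (x : SL2Cover) :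
    x.mat 1 0 = Real.exp (x.log UpperHalfPlane.I).re * Real.sin x.theta := by
  have h := congrArg Complex.im (exp_log_I x)
  rw [Complex.exp_im] at h
  rw [theta, h]
  simp [den]

theorem entry_11_eq (x : SL2Cover) :
    x.mat 1 1 = Real.exp (x.log UpperHalfPlane.I).re * Real.cos x.theta := by
  have h := congrArg Complex.re (exp_log_I x)
  rw [Complex.exp_re] at h
  rw [theta, h]
  simp [den]

theorem theta_center_zpow_mul (j : ℤ) (x : SL2Cover) :
    theta (centerGen ^ j * x) = Real.pi * j + theta x := by
  have key : ∀ y : SL2Cover, theta (centerGen * y) = Real.pi + theta y := fun y => by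
    simp [theta]
  induction j using Int.induction_on with
  | zero => simp
  | succ n ih =>
    rw [add_comm, zpow_add, zpow_one, mul_assoc, key, ih]
    push_cast
    ring
  | pred n ih =>
    have h := key (centerGen ^ (-(n : ℤ) - 1) * x)
    rw [← mul_assoc, ← zpow_one_add, add_sub_cancel, ih] at h
    push_cast at h ⊢
    linarith

/-- The matrix determines the modulus of the automorphy factor, hence the real part of its
logarithm; only the argument is left. -/
theorem eq_of_mat_eq_of_theta_eq {x y : SL2Cover} (h : x.mat = y.mat) (h' : theta x = theta y) :
    x = y := by
  refine ext_I h (Complex.ext ?_ h')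
  have h1 := exp_log_I x
  rw [h, ← exp_log_I y] at h1
  have h2 := congrArg (fun z : ℂ => ‖z‖) h1
  simpa [Complex.norm_exp] using h2

/-- Two logarithms of the same automorphy factor differ by `2 π i n`, while `centerGen` adds `π i`;
the kernel of the covering is therefore generated by the square of `centerGen`. -/
theorem exists_center_zpow_mul_of_mat_eq {x y : SL2Cover} (h : x.mat = y.mat) :
    ∃ i : ℤ, x = centerGen ^ (2 * i) * y := by
  have h1 := exp_log_I x
  rw [h, ← exp_log_I y] at h1
  obtain ⟨n, hn⟩ := Complex.exp_eq_exp_iff_exists_int.1 h1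
  refine ⟨n, eq_of_mat_eq_of_theta_eq ?_ ?_⟩
  · rw [mul_mat, h, zpow_mul]
    have h2 : (centerGen ^ (2 : ℤ)).mat = 1 := by
      rw [zpow_ofNat, sq]
      simp
    have h3 : ((centerGen ^ (2 : ℤ)) ^ n).mat = (centerGen ^ (2 : ℤ)).mat ^ n := map_zpow proj _ _
    rw [h3, h2]
    simp
  · rw [theta_center_zpow_mul, theta, hn, theta]
    simp
    ring

theorem center_zpow_mul_entry (j : ℤ) (x : SL2Cover) (i k : Fin 2) :
    (centerGen ^ j * x).mat i k = (-1) ^ j * x.mat i k := by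
  have key : ∀ y : SL2Cover, (centerGen * y).mat i k = -y.mat i k := fun y => by
    simp
  have hne : (-1 : ℝ) ≠ 0 := by norm_num
  induction j using Int.induction_on with
  | zero => simp
  | succ n ih =>
    rw [add_comm, zpow_add, zpow_one, mul_assoc, key, ih, zpow_one_add₀ hne]
    ring
  | pred n ih =>
    have h := key (centerGen ^ (-(n : ℤ) - 1) * x)
    rw [← mul_assoc, ← zpow_one_add, add_sub_cancel, ih] at h
    rw [zpow_sub_one₀ hne]
    linarith

/-- The lower unipotent one-parameter subgroup. -/
noncomputable def lowerUnip (s : ℝ) : SL2Cover := weyl * unip (-s) * weyl⁻¹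

theorem lowerUnip_10 (s : ℝ) : (lowerUnip s).mat 1 0 = s := by
  simp only [lowerUnip, mul_entry]
  simp

theorem cartan_mul_lowerUnip (t s : ℝ) :
    cartan t * lowerUnip s = lowerUnip (Real.exp (-(2 * t)) * s) * cartan t := by
  have h := cartan_mul_unip (-t) (-s)
  have h1 : cartan (-t) * weyl⁻¹ = weyl⁻¹ * cartan t := by
    rw [eq_inv_mul_iff_mul_eq, ← mul_assoc, ← cartan_mul_weyl, mul_assoc, mul_inv_cancel, mul_one]
  rw [lowerUnip, ← mul_assoc, ← mul_assoc, cartan_mul_weyl, mul_assoc weyl, h, lowerUnip,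
    mul_assoc _ _ (cartan t), ← h1]
  simp only [mul_assoc]
  ring_nf

theorem theta_cartan_mul (t : ℝ) (x : SL2Cover) : theta (cartan t * x) = theta x := by
  simp [theta]

/-- Since `weyl` carries the principal logarithm, `theta (lowerUnip s)` is the argument of a point
of the upper half-plane minus `π / 2`. This coarse bound and the sign of the lower left entry `s`
determine the sheet of `lowerUnip s` when `s = 1` or `s = -1`. -/
theorem theta_lowerUnip (s : ℝ) :
    -Real.pi < theta (lowerUnip s) ∧ theta (lowerUnip s) < Real.pi := by
  have h : weyl.mat⁻¹ • UpperHalfPlane.I = UpperHalfPlane.I := by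
    rw [inv_smul_eq_iff]
    ext
    rw [UpperHalfPlane.coe_specialLinearGroup_apply]
    simp
  have h1 : theta (lowerUnip s) = Complex.arg
      (((unip (-s)).mat • UpperHalfPlane.I : UpperHalfPlane) : ℂ) - Real.pi / 2 := by
    simp [theta, lowerUnip, h, Complex.log_I, Complex.log_im]
    ring
  have h2 := Complex.arg_nonneg_iff.2
    ((unip (-s)).mat • UpperHalfPlane.I : UpperHalfPlane).im_pos.le
  have h3 := Complex.arg_le_pi (((unip (-s)).mat • UpperHalfPlane.I : UpperHalfPlane) : ℂ)
  have := Real.pi_pos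
  constructor <;> linarith

theorem theta_lowerUnip_one : theta (lowerUnip 1) ∈ Ioo 0 Real.pi := by
  obtain ⟨h1, h2⟩ := theta_lowerUnip 1
  refine ⟨?_, h2⟩
  by_contra! h
  have h3 := Real.sin_nonpos_of_nonpos_of_neg_pi_le h h1.le
  have h4 := entry_10_eq (lowerUnip 1)
  rw [lowerUnip_10] at h4
  nlinarith [Real.exp_pos ((lowerUnip 1).log UpperHalfPlane.I).re]

theorem theta_lowerUnip_neg_one : theta (lowerUnip (-1)) ∈ Ioo (-Real.pi) 0 := by
  obtain ⟨h1, h2⟩ := theta_lowerUnip (-1)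
  refine ⟨h1, ?_⟩
  by_contra! h
  have h3 := Real.sin_nonneg_of_nonneg_of_le_pi h h2.le
  have h4 := entry_10_eq (lowerUnip (-1))
  rw [lowerUnip_10] at h4
  nlinarith [Real.exp_pos ((lowerUnip (-1)).log UpperHalfPlane.I).re]

/-! ### The upper triangular elements of the cover and the sheets between them. -/

theorem exists_eq_cartan_mul_unip {x : SL2Cover} (h : x.mat 1 0 = 0) (hx : theta x = 0) :
    ∃ t q, x = cartan t * unip q := by
  have hd : 0 < x.mat 1 1 := by
    rw [entry_11_eq, hx, Real.cos_zero, mul_one]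
    exact Real.exp_pos _
  have hdet := det_entries x
  rw [h, mul_zero, sub_zero] at hdet
  refine ⟨-Real.log (x.mat 1 1), x.mat 0 1 * x.mat 1 1,
    eq_of_mat_eq_of_theta_eq (mat_eq_of_entries ?_ ?_ ?_ ?_) ?_⟩
  any_goals rw [mul_entry]; simp [Real.exp_neg, Real.exp_log hd, h]
  · exact eq_inv_of_mul_eq_one_left hdet
  · field_simp
  · rw [hx, theta_cartan_mul]
    simp [theta]

/-- The boundary levels of the sheets are the cosets of `AN` by the centre: dividing by `centerGen ^
k` brings the argument to `0`. -/
theorem exists_eq_center_zpow_mul {x : SL2Cover} {k : ℤ} (hx : theta x = Real.pi * k) :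
    ∃ t q, x = centerGen ^ k * (cartan t * unip q) := by
  have h1 := theta_center_zpow_mul (-k) x
  have h2 : (centerGen ^ (-k) * x).mat 1 0 = 0 := by
    rw [center_zpow_mul_entry, entry_10_eq, hx, mul_comm Real.pi, Real.sin_int_mul_pi]
    simp
  obtain ⟨t, q, h⟩ := exists_eq_cartan_mul_unip h2 (by rw [h1, hx]; push_cast; ring)
  refine ⟨t, q, ?_⟩
  rw [← h]
  simp

/-- The components of the complement of the parabolic subgroup of upper triangular matrices. -/
def sheet (j : ℤ) : Set SL2Cover := theta ⁻¹' Ioo (Real.pi * j) (Real.pi * (j + 1))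

theorem isOpen_sheet (j : ℤ) : IsOpen (sheet j) := isOpen_Ioo.preimage continuous_theta

theorem sin_sheet {j : ℤ} {x : SL2Cover} (hx : x ∈ sheet j) :
    0 < (-1 : ℝ) ^ j * x.mat 1 0 := by
  rw [entry_10_eq, mul_left_comm, ← Real.sin_sub_int_mul_pi]
  obtain ⟨h1, h2⟩ : _ ∧ _ := hx
  exact mul_pos (Real.exp_pos _) (Real.sin_pos_of_pos_of_lt_pi (by linarith) (by linarith))

theorem entry_10_ne_zero_of_mem_sheet {j : ℤ} {x : SL2Cover} (hx : x ∈ sheet j) :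
    x.mat 1 0 ≠ 0 := fun h => by
  have := sin_sheet hx
  simp [h] at this

theorem entry_10_mul_pos_of_mem_sheet {j : ℤ} {x y : SL2Cover} (hx : x ∈ sheet j)
    (hy : y ∈ sheet j) : 0 < x.mat 1 0 * y.mat 1 0 := by
  have h := mul_pos (sin_sheet hx) (sin_sheet hy)
  rcases Int.even_or_odd j with h' | h' <;> rw [h'.neg_one_zpow] at h <;> linarith

theorem sin_theta_ne_zero {x : SL2Cover} (hx : x.mat 1 0 ≠ 0) : Real.sin (theta x) ≠ 0 := by
  intro h
  rw [entry_10_eq, h] at hx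
  simp at hx

theorem exists_mem_sheet {x : SL2Cover} (hx : x.mat 1 0 ≠ 0) : ∃ j, x ∈ sheet j := by
  have hp := Real.pi_pos
  refine ⟨⌊theta x / Real.pi⌋, lt_of_le_of_ne ?_ ?_, ?_⟩
  · have := Int.floor_le (theta x / Real.pi)
    rw [le_div_iff₀ hp] at this
    linarith
  · intro h
    apply sin_theta_ne_zero hx
    rw [← h, mul_comm, Real.sin_int_mul_pi]
  · have := Int.lt_floor_add_one (theta x / Real.pi)
    rw [div_lt_iff₀ hp] at this
    linarith

/-- Intermediate value theorem for `theta`: a connected set can leave a sheet only across one of its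
two boundary levels. -/
theorem _root_.IsPreconnected.exists_theta_eq {T : Set SL2Cover} (hT : IsPreconnected T)
    {j : ℤ} {x : SL2Cover} (hx : x ∈ T) (hj : x ∈ sheet j) (h : ¬T ⊆ sheet j) :
    ∃ z ∈ T, theta z = Real.pi * j ∨ theta z = Real.pi * (j + 1) := by
  obtain ⟨y, hy, hyj⟩ := not_subset.1 h
  have hord := (hT.image theta continuous_theta.continuousOn).ordConnected
  obtain ⟨h1, h2⟩ : _ ∧ _ := hj
  rcases not_and_or.1 hyj with h3 | h3
  · obtain ⟨z, hz, hz'⟩ := hord.out (mem_image_of_mem _ hy) (mem_image_of_mem _ hx)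
      ⟨not_lt.1 h3, h1.le⟩
    exact ⟨z, hz, Or.inl hz'⟩
  · obtain ⟨z, hz, hz'⟩ := hord.out (mem_image_of_mem _ hx) (mem_image_of_mem _ hy)
      ⟨h2.le, not_lt.1 h3⟩
    exact ⟨z, hz, Or.inr hz'⟩

theorem _root_.IsPreconnected.subset_sheet {T : Set SL2Cover} (hT : IsPreconnected T)
    (h : ∀ x ∈ T, x.mat 1 0 ≠ 0) {j : ℤ} {x : SL2Cover} (hx : x ∈ T) (hj : x ∈ sheet j) :
    T ⊆ sheet j := by
  by_contra hn
  obtain ⟨z, hz, hz'⟩ := hT.exists_theta_eq hx hj hn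
  apply sin_theta_ne_zero (h z hz)
  rcases hz' with hz' | hz' <;> rw [hz', mul_comm]
  · exact Real.sin_int_mul_pi j
  · exact_mod_cast Real.sin_int_mul_pi (j + 1)

theorem sheet_injective {j k : ℤ} {x : SL2Cover} (hj : x ∈ sheet j) (hk : x ∈ sheet k) :
    j = k := by
  obtain ⟨h1, h2⟩ : _ ∧ _ := hj
  obtain ⟨h3, h4⟩ : _ ∧ _ := hk
  have a1 := lt_of_mul_lt_mul_left (h1.trans h4) Real.pi_pos.le
  have a2 := lt_of_mul_lt_mul_left (h3.trans h2) Real.pi_pos.le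
  norm_cast at a1 a2
  lia

/-! ### Bruhat coordinates on the sheets. -/

theorem continuous_cartan : Continuous cartan := by
  refine continuous_induced_rng.2 (Continuous.prodMk ?_ ?_)
  · refine continuous_induced_rng.2 ?_
    change Continuous fun t : ℝ => !![Real.exp t, 0; 0, Real.exp (-t)]
    fun_prop
  · simp only [cartan_log]
    fun_prop

theorem continuous_unip : Continuous unip := by
  refine continuous_induced_rng.2 (Continuous.prodMk ?_ ?_)
  · refine continuous_induced_rng.2 ?_
    change Continuous fun q : ℝ => !![1, q; 0, 1]
    fun_prop
  · simp only [unip_log]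
    fun_prop

/-- Bruhat coordinates of the open cell `N w A N`. -/
noncomputable def bruhat (p : ℝ × ℝ × ℝ) : SL2Cover :=
  unip p.1 * weyl * cartan p.2.1 * unip p.2.2

theorem continuous_bruhat : Continuous bruhat := by
  have h1 := continuous_cartan
  have h2 := continuous_unip
  unfold bruhat
  fun_prop

theorem bruhat_10 (p : ℝ × ℝ × ℝ) : (bruhat p).mat 1 0 = Real.exp p.2.1 := by
  simp only [bruhat, mul_entry]
  simp

theorem bruhat_00 (p : ℝ × ℝ × ℝ) : (bruhat p).mat 0 0 = p.1 * Real.exp p.2.1 := by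
  simp only [bruhat, mul_entry]
  simp

theorem bruhat_11 (p : ℝ × ℝ × ℝ) : (bruhat p).mat 1 1 = Real.exp p.2.1 * p.2.2 := by
  simp only [bruhat, mul_entry]
  simp

theorem bruhat_mem (p : ℝ × ℝ × ℝ) : bruhat p ∈ sheet 0 := by
  have : theta (bruhat p) = Complex.arg
      (((cartan p.2.1).mat • (unip p.2.2).mat • UpperHalfPlane.I : UpperHalfPlane) : ℂ) := by
    simp [theta, bruhat, Complex.log_im]
  set τ := ((cartan p.2.1).mat • (unip p.2.2).mat • UpperHalfPlane.I : UpperHalfPlane)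
  simp only [sheet, mem_preimage, this, mem_Ioo, Int.cast_zero, mul_zero, zero_add, mul_one]
  have h0 : Complex.arg τ ≠ 0 := fun h => by
    have := (Complex.arg_eq_zero_iff.1 h).2
    exact τ.im_pos.ne' this
  refine ⟨lt_of_le_of_ne (Complex.arg_nonneg_iff.2 τ.im_pos.le) h0.symm,
    Complex.arg_lt_pi_iff.2 (Or.inr τ.im_pos.ne')⟩

/-- The entries `a`, `c`, `d` determine the Bruhat coordinates, and `b` follows from the
determinant. The lifts agree because both arguments lie in `(0, π)`, where the exponential is
injective. -/
theorem bruhat_entries {x : SL2Cover} (hx : x ∈ sheet 0) :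
    bruhat (x.mat 0 0 / x.mat 1 0, Real.log (x.mat 1 0), x.mat 1 1 / x.mat 1 0) = x := by
  have hc : 0 < x.mat 1 0 := by simpa using sin_sheet hx
  set p : ℝ × ℝ × ℝ := (x.mat 0 0 / x.mat 1 0, Real.log (x.mat 1 0), x.mat 1 1 / x.mat 1 0)
  have h00 : (bruhat p).mat 0 0 = x.mat 0 0 := by
    rw [bruhat_00, Real.exp_log hc, div_mul_cancel₀ _ hc.ne']
  have h10 : (bruhat p).mat 1 0 = x.mat 1 0 := by
    rw [bruhat_10, Real.exp_log hc]
  have h11 : (bruhat p).mat 1 1 = x.mat 1 1 := by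
    rw [bruhat_11, Real.exp_log hc, mul_div_cancel₀ _ hc.ne']
  have hm : (bruhat p).mat = x.mat := by
    refine mat_eq_of_entries h00 ?_ h10 h11
    have d1 := det_entries x
    have d2 := det_entries (bruhat p)
    rw [h00, h10, h11] at d2
    apply mul_right_cancel₀ hc.ne'
    linarith
  refine ext_I hm ?_
  obtain ⟨a1, a2⟩ : _ ∧ _ := bruhat_mem p
  obtain ⟨b1, b2⟩ : _ ∧ _ := hx
  simp only [Int.cast_zero, mul_zero, zero_add, mul_one, theta] at a1 a2 b1 b2
  have hp := Real.pi_pos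
  refine Complex.exp_inj_of_neg_pi_lt_of_le_pi (by linarith) a2.le (by linarith) b2.le ?_
  rw [exp_log_I, exp_log_I, hm]

theorem isOpenEmbedding_bruhat : IsOpenEmbedding bruhat := by
  let e : OpenPartialHomeomorph (ℝ × ℝ × ℝ) SL2Cover :=
    { toFun := bruhat
      invFun := fun x => (x.mat 0 0 / x.mat 1 0, Real.log (x.mat 1 0), x.mat 1 1 / x.mat 1 0)
      source := univ
      target := sheet 0
      map_source' := fun p _ => bruhat_mem p
      map_target' := fun _ _ => mem_univ _
      left_inv' := fun p _ => by
        have := Real.exp_ne_zero p.2.1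
        simp [bruhat_00, bruhat_10, bruhat_11, this]
      right_inv' := fun x hx => bruhat_entries hx
      open_source := isOpen_univ
      open_target := isOpen_sheet 0
      continuousOn_toFun := continuous_bruhat.continuousOn
      continuousOn_invFun := by
        have h : ∀ x ∈ sheet 0, x.mat 1 0 ≠ 0 := fun x => entry_10_ne_zero_of_mem_sheet
        have h1 := fun i j => (continuous_entry i j).continuousOn (s := sheet 0)
        exact ((h1 0 0).div (h1 1 0) h).prodMk
          (((h1 1 0).log h).prodMk ((h1 1 1).div (h1 1 0) h)) }
  exact e.isOpenEmbedding rfl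

/-- Bruhat coordinates on a sheet. -/
noncomputable def chart (j : ℤ) (p : ℝ × ℝ × ℝ) : SL2Cover := centerGen ^ j * bruhat p

theorem isOpenEmbedding_chart (j : ℤ) : IsOpenEmbedding (chart j) :=
  (Homeomorph.mulLeft (centerGen ^ j)).isOpenEmbedding.comp isOpenEmbedding_bruhat

theorem center_zpow_mul_mem_sheet {i j : ℤ} {x : SL2Cover} :
    centerGen ^ i * x ∈ sheet j ↔ x ∈ sheet (j - i) := by
  simp only [sheet, mem_preimage, theta_center_zpow_mul, mem_Ioo]
  push_cast
  constructor <;> rintro ⟨h1, h2⟩ <;> constructor <;> linarith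

theorem range_chart (j : ℤ) : range (chart j) = sheet j := by
  ext x
  constructor
  · rintro ⟨p, rfl⟩
    rw [chart, center_zpow_mul_mem_sheet, sub_self]
    exact bruhat_mem p
  · intro hx
    have h : centerGen ^ (-j) * x ∈ sheet 0 := by
      rw [center_zpow_mul_mem_sheet]
      simpa using hx
    refine ⟨_, (congrArg _ (bruhat_entries h)).trans ?_⟩
    simp

end SL2Cover

namespace BHTZ

open SL2Cover

/-! ### Proper actions -/

/-- On a compact set `F` is bounded, by `B` say, so a return at time `n` forces `c |n| ≤ 2 B`. Near
a point, a set on which `F` varies by less than `c` is disjoint from its images at all nonzero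
times. All properness in the file comes from such an `F`, always the logarithm of an expanded or
contracted quantity. -/
theorem actsProperlyDiscontinuously_of_displacement {X : Type*} [TopologicalSpace X]
    {f : ℤ → X → X} {U : Set X} {F : X → ℝ} {c : ℝ} (hc : 0 < c) (hF : ContinuousOn F U)
    (h : ∀ n : ℤ, ∀ x ∈ U, c * |(n : ℝ)| ≤ |F (f n x) - F x|) :
    ActsProperlyDiscontinuously f U := by
  refine ⟨fun K hKU hK => ?_, fun x hx => ?_⟩
  · obtain ⟨B, hB⟩ := hK.exists_bound_of_continuousOn (hF.mono hKU)
    refine (Set.finite_Icc (-⌈2 * B / c⌉) ⌈2 * B / c⌉).subset ?_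
    rintro n ⟨_, ⟨x, hx, rfl⟩, hx'⟩
    have h1 := h n x (hKU hx)
    have h2 := abs_sub (F (f n x)) (F x)
    have h3 : |F x| ≤ B := hB x hx
    have h4 : |F (f n x)| ≤ B := hB _ hx'
    have h5 : |(n : ℝ)| ≤ 2 * B / c := by
      rw [le_div_iff₀ hc]
      linarith
    have h6 := h5.trans (Int.le_ceil _)
    exact abs_le.1 (by exact_mod_cast h6)
  · refine ⟨F ⁻¹' Metric.ball (F x) (c / 2) ∩ U,
      Filter.inter_mem (hF x hx (Metric.ball_mem_nhds _ (half_pos hc))) self_mem_nhdsWithin, ?_⟩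
    intro n hn
    rw [Set.disjoint_left]
    rintro _ ⟨y, ⟨hy, hyU⟩, rfl⟩ ⟨hy', -⟩
    have h1 := h n y hyU
    have h2 : (1 : ℝ) ≤ |(n : ℝ)| := by exact_mod_cast Int.one_le_abs hn
    rw [mem_preimage, Metric.mem_ball, Real.dist_eq] at hy hy'
    have h3 := abs_sub_le (F (f n y)) (F x) (F y)
    rw [abs_sub_comm (F x)] at h3
    nlinarith

/-- The sequence `x`, its translates and the two limits form, after discarding finitely many terms,
a compact subset of `U` that returns to itself at infinitely many times. In the quotient, `y` and
`z` could not be separated. -/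
theorem ActsProperlyDiscontinuously.false_of_tendsto {X : Type*} [TopologicalSpace X]
    {f : ℤ → X → X} {U : Set X} (h : ActsProperlyDiscontinuously f U) (hU : IsOpen U)
    {x : ℕ → X} {k : ℕ → ℤ} (hk : Function.Injective k) {y z : X} (hy : y ∈ U) (hz : z ∈ U)
    (hx : Filter.Tendsto x Filter.atTop (𝓝 z))
    (hfx : Filter.Tendsto (fun n => f (k n) (x n)) Filter.atTop (𝓝 y)) : False := by
  obtain ⟨N, hN⟩ := Filter.eventually_atTop.1
    ((hx.eventually (hU.mem_nhds hz)).and (hfx.eventually (hU.mem_nhds hy)))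
  have h1 := (Filter.tendsto_add_atTop_iff_nat N).2 hx
  have h2 := (Filter.tendsto_add_atTop_iff_nat N).2 hfx
  have hfin := h.1 _ ?_ (h1.isCompact_insert_range.union h2.isCompact_insert_range)
  · refine Set.infinite_range_of_injective (f := fun n => k (n + N))
      (fun a b hab => by simpa using hk hab) (hfin.subset ?_)
    rintro _ ⟨n, rfl⟩
    exact ⟨f (k (n + N)) (x (n + N)), mem_image_of_mem _ (Or.inl (Or.inr ⟨n, rfl⟩)),
      Or.inr (Or.inr ⟨n, rfl⟩)⟩
  · rintro w ((rfl | ⟨n, rfl⟩) | (rfl | ⟨n, rfl⟩))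
    · exact hz
    · exact (hN _ (Nat.le_add_left N n)).1
    · exact hy
    · exact (hN _ (Nat.le_add_left N n)).2

theorem units_mul_self (ε : ℤˣ) (n : ℤ) : (ε : ℤ) * (ε * n) = n := by
  rcases Int.units_eq_one_or ε with rfl | rfl <;> simp

theorem ActsProperlyDiscontinuously.image {X Y : Type*} [TopologicalSpace X] [TopologicalSpace Y]
    {f : ℤ → X → X} {f' : ℤ → Y → Y} (e : X ≃ₜ Y) (ε : ℤˣ)
    (h : ∀ n x, e (f n x) = f' (ε * n) (e x)) {U : Set X}
    (hU : ActsProperlyDiscontinuously f U) : ActsProperlyDiscontinuously f' (e '' U) := by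
  have h' : ∀ n x, f' n (e x) = e (f (ε * n) x) := fun n x => by rw [h, units_mul_self]
  have hinj : Function.Injective fun n : ℤ => (ε : ℤ) * n := fun a b hab => by
    have := congrArg (fun n => (ε : ℤ) * n) hab
    simpa only [units_mul_self] using this
  refine ⟨fun K hKU hK => ?_, ?_⟩
  · have hfin := hU.1 (e ⁻¹' K) (fun x hx => ?_) (e.isCompact_preimage.2 hK)
    · refine (hfin.preimage hinj.injOn).subset ?_
      rintro n ⟨_, ⟨x, hx, rfl⟩, hx'⟩
      obtain ⟨x, rfl⟩ := e.surjective x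
      rw [h'] at hx'
      exact ⟨_, mem_image_of_mem _ hx, hx'⟩
    · obtain ⟨y, hy, hyx⟩ := hKU hx
      rwa [← e.injective hyx]
  · rintro _ ⟨x, hx, rfl⟩
    obtain ⟨V, hV, hd⟩ := hU.2 x hx
    refine ⟨e '' V, ?_, fun n hn => ?_⟩
    · rw [← e.isEmbedding.map_nhdsWithin_eq]
      exact Filter.image_mem_map hV
    · rw [Set.disjoint_left]
      rintro _ ⟨_, ⟨y, hy, rfl⟩, rfl⟩ hy'
      rw [h', e.injective.mem_set_image] at hy'
      exact Set.disjoint_left.1 (hd (ε * n) (by simpa using hn)) (mem_image_of_mem _ hy) hy'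

theorem maximal_image {X : Type*} {P Q : Set X → Prop} (e : X ≃ X)
    (h : ∀ U, P U → Q (e '' U)) (h' : ∀ U, Q U → P (e.symm '' U)) {U : Set X}
    (hU : Maximal P U) : Maximal Q (e '' U) := by
  refine ⟨h _ hU.1, fun V hV hle => ?_⟩
  have h1 : U ⊆ e.symm '' V := by
    rw [← e.symm_image_image U]
    exact image_mono hle
  have h2 := image_mono (f := e) (hU.2 (h' V hV) h1)
  rwa [e.image_symm_image] at h2

/-! ### Transport of structure -/

/-- A homeomorphism which carries the `ℤ`-action of `D` to that of `D'`, up to a sign. -/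
def Intertwines (D D' : KillingDatum) (e : SL2Cover ≃ₜ SL2Cover) : Prop :=
  ∃ ε : ℤˣ, ∀ (n : ℤ) (x : SL2Cover), e (D.zAct n x) = D'.zAct (ε * n) (e x)

/-- The homeomorphism carries the norm of the Killing field of `D` to that of `D'`. -/
def PreservesNorm (D D' : KillingDatum) (e : SL2Cover ≃ₜ SL2Cover) : Prop :=
  ∀ x, killing (D'.killingVector (e x)) (D'.killingVector (e x)) =
    killing (D.killingVector x) (D.killingVector x)

variable {D D' : KillingDatum} {e : SL2Cover ≃ₜ SL2Cover} {U E : Set SL2Cover}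

theorem Intertwines.symm (h : Intertwines D D' e) : Intertwines D' D e.symm := by
  obtain ⟨ε, h⟩ := h
  refine ⟨ε, fun n x => e.injective ?_⟩
  rw [h, units_mul_self]
  simp

theorem PreservesNorm.symm (h : PreservesNorm D D' e) : PreservesNorm D' D e.symm := fun x => by
  rw [← h]
  simp

theorem IsAdmissible.image (h : Intertwines D D' e) (hU : IsAdmissible D U) :
    IsAdmissible D' (e '' U) := by
  obtain ⟨ε, h⟩ := h
  refine ⟨e.isOpenMap _ hU.isOpen, e.isSimplyConnected_image.2 hU.simplyConnected, ?_,
    hU.proper.image e ε h⟩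
  rintro n _ ⟨x, hx, rfl⟩
  refine ⟨D.zAct (ε * n) x, hU.stable _ _ hx, ?_⟩
  rw [h, units_mul_self]

theorem IsExtensionDomain.image (h : Intertwines D D' e) (hE : IsExtensionDomain D E) :
    IsExtensionDomain D' (e '' E) :=
  maximal_image e.toEquiv (fun _ => IsAdmissible.image h) (fun _ => IsAdmissible.image h.symm) hE

theorem IsBHTZDomain.image (h : Intertwines D D' e) (h' : PreservesNorm D D' e)
    (hU : IsBHTZDomain D U) : IsBHTZDomain D' (e '' U) := by
  refine maximal_image e.toEquiv (fun U hU => ⟨hU.1.image h, ?_⟩)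
    (fun U hU => ⟨hU.1.image h.symm, ?_⟩) hU
  · rintro _ ⟨x, hx, rfl⟩
    exact (hU.2 x hx).trans_eq (h' x).symm
  · rintro _ ⟨x, hx, rfl⟩
    exact (hU.2 x hx).trans_eq (h'.symm x).symm

theorem FoliatedByOrbits.image {b b' : Bool} (κ : neutral b ≃ₜ neutral b') (hκ : κ 1 = 1)
    (h : ∀ (r : neutral b) x, e (act D r x) = act D' (κ r) (e x))
    (hE : FoliatedByOrbits D b E) : FoliatedByOrbits D' b' (e '' E) := by
  refine ⟨?_, ?_⟩
  · rintro r hr _ ⟨x, hx, rfl⟩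
    refine ⟨act D (κ.symm ⟨r, hr⟩) x, hE.1 _ (κ.symm ⟨r, hr⟩).2 x hx, ?_⟩
    rw [h, κ.apply_symm_apply]
  · rintro _ ⟨x, hx, rfl⟩
    obtain ⟨V, s, hV, hV1, hs0, hs, hemb⟩ := hE.2 x hx
    refine ⟨κ '' V, fun u => e (s u), κ.isOpenMap _ hV, ⟨1, hV1, hκ⟩, congrArg e hs0,
      fun u => mem_image_of_mem _ (hs u), ?_⟩
    have := (e.isOpenEmbedding.comp hemb).comp
      ((κ.image V).symm.prodCongr (Homeomorph.refl ℝ)).isOpenEmbedding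
    convert this using 1
    funext ⟨⟨_, r, hr, rfl⟩, u⟩
    have : (κ.image V).symm ⟨κ r, mem_image_of_mem _ hr⟩ = ⟨r, hr⟩ := by
      rw [Homeomorph.symm_apply_eq]
      rfl
    simp [this, h]

end BHTZ

namespace BHTZ

open SL2Cover

/-! ### The neutral components of the parabolic subgroups -/

theorem coe_neutral (b : Bool) :
    (neutral b : Set SL2Cover) = connectedComponentIn (parabolic b : Set SL2Cover) 1 := by
  rw [connectedComponentIn_eq_image (parabolic b).one_mem]
  rfl

theorem mem_parabolic_true {x : SL2Cover} : x ∈ parabolic true ↔ x.mat 1 0 = 0 := Iff.rfl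

theorem mem_parabolic_false {x : SL2Cover} : x ∈ parabolic false ↔ x.mat 0 1 = 0 := Iff.rfl

/-- On the upper triangular group `theta` takes values in the discrete set `π ℤ`, so by
connectedness it vanishes on the neutral component. -/
theorem mem_neutral_true {r : SL2Cover} :
    r ∈ neutral true ↔ ∃ t q, r = cartan t * unip q := by
  rw [← SetLike.mem_coe, coe_neutral]
  constructor
  · intro hr
    have h10 : r.mat 1 0 = 0 := mem_parabolic_true.1 (connectedComponentIn_subset _ _ hr)
    refine exists_eq_cartan_mul_unip h10 ?_
    set T := connectedComponentIn (parabolic true : Set SL2Cover) 1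
    have hord := (isPreconnected_connectedComponentIn.image theta
      continuous_theta.continuousOn : IsPreconnected (theta '' T)).ordConnected
    have h1 : (1 : SL2Cover) ∈ T := mem_connectedComponentIn (parabolic true).one_mem
    have h1' : (0 : ℝ) ∈ theta '' T := ⟨1, h1, by simp [theta]⟩
    have hr' : theta r ∈ theta '' T := mem_image_of_mem _ hr
    have hsin : ∀ v ∈ theta '' T, Real.sin v = 0 := by
      rintro _ ⟨y, hy, rfl⟩
      have hy0 : y.mat 1 0 = 0 := mem_parabolic_true.1 (connectedComponentIn_subset _ _ hy)
      rw [entry_10_eq] at hy0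
      exact (mul_eq_zero.1 hy0).resolve_left (Real.exp_ne_zero _)
    have hp := Real.pi_pos
    rcases lt_trichotomy (theta r) 0 with h | h | h
    · exfalso
      -- Truncation at `-1` gives a value of `theta` in `(-π, 0)`, where the sine does not vanish;
      -- the case `0 < theta r` uses `1` in the same way.
      have hm : max (theta r) (-1) ∈ theta '' T :=
        hord.out hr' h1' ⟨le_max_left _ _, max_le h.le (by norm_num)⟩
      have hlt : max (theta r) (-1) < 0 := max_lt h (by norm_num)
      have := Real.sin_neg_of_neg_of_neg_pi_lt hlt
        (lt_of_lt_of_le (by linarith [Real.pi_gt_three]) (le_max_right _ _))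
      exact this.ne (hsin _ hm)
    · exact h
    · exfalso
      have hm : min (theta r) 1 ∈ theta '' T :=
        hord.out h1' hr' ⟨le_min h.le (by norm_num), min_le_left _ _⟩
      have hlt : 0 < min (theta r) 1 := lt_min h (by norm_num)
      have := Real.sin_pos_of_pos_of_lt_pi hlt
        (lt_of_le_of_lt (min_le_right _ _) (by linarith [Real.pi_gt_three]))
      exact this.ne' (hsin _ hm)
  · rintro ⟨t, q, rfl⟩
    have hc : Continuous fun p : ℝ × ℝ => cartan p.1 * unip p.2 :=
      (continuous_cartan.comp continuous_fst).mul (continuous_unip.comp continuous_snd)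
    refine (isPreconnected_range hc).subset_connectedComponentIn (x := 1) ⟨(0, 0), by simp⟩ ?_
      ⟨(t, q), rfl⟩
    rintro _ ⟨p, rfl⟩
    change (cartan p.1 * unip p.2).mat 1 0 = 0
    rw [mul_entry]
    simp

/-- The coordinates `(t, q)` of `cartan t * unip q` on the group `AN`. -/
noncomputable def neutralHomeo : ℝ × ℝ ≃ₜ neutral true where
  toFun p := ⟨cartan p.1 * unip p.2, mem_neutral_true.2 ⟨_, _, rfl⟩⟩
  invFun r := (Real.log ((r : SL2Cover).mat 0 0), (r : SL2Cover).mat 0 1 / (r : SL2Cover).mat 0 0)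
  left_inv p := by
    have := Real.exp_ne_zero p.1
    simp only [mul_entry]
    simp [this]
  right_inv r := by
    obtain ⟨r, hr⟩ := r
    obtain ⟨t, q, rfl⟩ := mem_neutral_true.1 hr
    have := Real.exp_ne_zero t
    apply Subtype.ext
    simp only [mul_entry]
    simp [this]
  continuous_toFun := by
    have h1 := continuous_cartan
    have h2 := continuous_unip
    fun_prop
  continuous_invFun := by
    have h : ∀ r : neutral true, (r : SL2Cover).mat 0 0 ≠ 0 := by
      rintro ⟨r, hr⟩
      obtain ⟨t, q, rfl⟩ := mem_neutral_true.1 hr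
      simp only [mul_entry]
      simp
    have h00 : Continuous fun r : neutral true => (r : SL2Cover).mat 0 0 :=
      (continuous_entry 0 0).comp continuous_subtype_val
    have h01 : Continuous fun r : neutral true => (r : SL2Cover).mat 0 1 :=
      (continuous_entry 0 1).comp continuous_subtype_val
    exact (h00.log h).prodMk (h01.div h00 h)

theorem coe_neutralHomeo (p : ℝ × ℝ) :
    (neutralHomeo p : SL2Cover) = cartan p.1 * unip p.2 := rfl

/-- Conjugation by `v`. -/
noncomputable def conjHomeo (v : SL2Cover) : SL2Cover ≃ₜ SL2Cover :=
  (Homeomorph.mulLeft v).trans (Homeomorph.mulRight v⁻¹)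

theorem conjHomeo_apply (v x : SL2Cover) : conjHomeo v x = v * x * v⁻¹ := rfl

theorem conjHomeo_symm_apply (v x : SL2Cover) : (conjHomeo v).symm x = v⁻¹ * x * v := by
  rw [Homeomorph.symm_apply_eq, conjHomeo_apply]
  group

theorem weyl_conj_entries (x : SL2Cover) :
    (weyl * x * weyl⁻¹).mat 0 0 = x.mat 1 1 ∧ (weyl * x * weyl⁻¹).mat 0 1 = -x.mat 1 0 ∧
      (weyl * x * weyl⁻¹).mat 1 0 = -x.mat 0 1 ∧ (weyl * x * weyl⁻¹).mat 1 1 = x.mat 0 0 := by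
  simp only [mul_entry]
  simp

/-- An element conjugating `AN` to the group under consideration and normalizing `A`. -/
noncomputable def twist (b : Bool) : SL2Cover := if b then 1 else weyl

@[simp] theorem twist_true : twist true = 1 := rfl
@[simp] theorem twist_false : twist false = weyl := rfl

theorem image_conjHomeo_neutral (b : Bool) :
    conjHomeo (twist b) '' (neutral true : Set SL2Cover) = neutral b := by
  have hpar : conjHomeo (twist b) '' (parabolic true : Set SL2Cover) = parabolic b := by
    ext x
    rw [← (conjHomeo (twist b)).preimage_symm, mem_preimage, conjHomeo_symm_apply, SetLike.mem_coe,
      SetLike.mem_coe, mem_parabolic_true]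
    cases b
    · rw [mem_parabolic_false]
      simp only [mul_entry]
      simp
    · rw [mem_parabolic_true]
      simp
  rw [coe_neutral, coe_neutral, Homeomorph.image_connectedComponentIn _ (parabolic true).one_mem,
    hpar, conjHomeo_apply]
  simp

/-- The isomorphism of `AN` with the group under consideration. -/
noncomputable def neutralTwist (b : Bool) : neutral true ≃ₜ neutral b :=
  ((conjHomeo (twist b)).image (neutral true)).trans
    (Homeomorph.setCongr (image_conjHomeo_neutral b))

theorem coe_neutralTwist (b : Bool) (r : neutral true) :
    (neutralTwist b r : SL2Cover) = twist b * r * (twist b)⁻¹ := rfl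

/-! ### The normal form -/

/-- The normal form of a generic BHTZ Killing field. -/
noncomputable def KillingDatum.normal (D : KillingDatum) : KillingDatum :=
  ⟨D.m, D.m', 1, 1, D.m_pos, D.m'_pos⟩

variable (D : KillingDatum)

theorem normal_zAct (n : ℤ) (x : SL2Cover) :
    D.normal.zAct n x = cartan (D.m * n) * x * cartan (-(D.m' * n)) := by
  simp [KillingDatum.zAct, KillingDatum.flow, KillingDatum.normal]

theorem normal_act (r x : SL2Cover) : act D.normal r x =
    if D.m = D.m' then tau r x
    else if D.m' < D.m then r * x * cartan (-(D.m' / D.m) * logA r)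
    else cartan (D.m / D.m' * logA r) * x * r⁻¹ := by
  simp [act, KillingDatum.normal, KillingDatum.fromNormal, KillingDatum.toNormal]

theorem toNormal_fromNormal (x : SL2Cover) : D.toNormal (D.fromNormal x) = x := by
  simp only [KillingDatum.fromNormal, KillingDatum.toNormal]
  group

theorem act_fromNormal (r x : SL2Cover) :
    act D r (D.fromNormal x) = D.fromNormal (act D.normal r x) := by
  rw [normal_act, act, toNormal_fromNormal]
  split_ifs <;> rfl

theorem zAct_fromNormal (n : ℤ) (x : SL2Cover) :
    D.zAct n (D.fromNormal x) = D.fromNormal (D.normal.zAct n x) := by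
  rw [normal_zAct]
  simp only [KillingDatum.zAct, KillingDatum.flow, KillingDatum.fromNormal]
  group

theorem zAct_weyl_conj (n : ℤ) (x : SL2Cover) :
    weyl * D.normal.zAct n x * weyl⁻¹ = D.normal.zAct (-n) (weyl * x * weyl⁻¹) := by
  rw [normal_zAct, normal_zAct]
  push_cast
  have h1 := cartan_mul_weyl (-(D.m * n))
  have h2 := cartan_mul_weyl (D.m' * n)
  rw [neg_neg] at h1
  have h3 : weyl⁻¹ * cartan (D.m' * n) = cartan (-(D.m' * n)) * weyl⁻¹ := by
    rw [inv_mul_eq_iff_eq_mul, ← mul_assoc, ← h2, mul_assoc, mul_inv_cancel, mul_one]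
  rw [mul_neg, mul_neg, neg_neg]
  calc _ = weyl * cartan (D.m * n) * x * (cartan (-(D.m' * n)) * weyl⁻¹) := by
        simp only [mul_assoc]
    _ = _ := by
        rw [← h1, ← h3]
        simp only [mul_assoc]

/-- As `σ` sends `weyl` to its inverse, the right factor is conjugated by `weyl⁻¹` instead of
`weyl`. The discrepancy is absorbed by `weyl * weyl = centerGen`, which is central. -/
theorem tau_weyl_conj (r x : SL2Cover) :
    tau (weyl * r * weyl⁻¹) (weyl * x * weyl⁻¹) = weyl * tau r x * weyl⁻¹ := by
  have h := (commute_center (weyl * (r * x * sigma r⁻¹) * weyl⁻¹)).eq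
  simp only [tau, mul_inv_rev, map_mul, map_inv, sigma_weyl, inv_inv]
  simp only [map_inv] at h
  have h2 : weyl * r * weyl⁻¹ * (weyl * x * weyl⁻¹) * (weyl⁻¹ * ((sigma r)⁻¹ * weyl)) =
      weyl * r * x * (weyl * weyl)⁻¹ * ((sigma r)⁻¹ * weyl) := by
    group
  rw [h2, weyl_mul_weyl, mul_assoc (weyl * r * x), ← mul_assoc _ _ weyl,
    ((commute_center (sigma r)⁻¹).inv_left).eq, ← weyl_mul_weyl]
  group

theorem logA_cartan_mul_unip (t q : ℝ) : logA (cartan t * unip q) = t := by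
  rw [logA, mul_entry]
  simp

theorem logA_weyl_conj (t q : ℝ) : logA (weyl * (cartan t * unip q) * weyl⁻¹) = -t := by
  rw [logA, (weyl_conj_entries _).1, mul_entry]
  simp

/-- Besides `tau_weyl_conj`, the point is that conjugation by `weyl` inverts `A`: it changes the
sign of `logA` and turns each factor `cartan s` into `cartan (-s)` accordingly. -/
theorem act_weyl_conj {r : SL2Cover} (hr : r ∈ neutral true) (x : SL2Cover) :
    act D.normal (weyl * r * weyl⁻¹) (weyl * x * weyl⁻¹) =
      weyl * act D.normal r x * weyl⁻¹ := by
  obtain ⟨t, q, rfl⟩ := mem_neutral_true.1 hr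
  rw [normal_act, normal_act, tau_weyl_conj, logA_weyl_conj, logA_cartan_mul_unip]
  have h : ∀ s : ℝ, cartan (-s) = weyl * cartan s * weyl⁻¹ := fun s => by
    have := cartan_mul_weyl (-s)
    rw [neg_neg] at this
    rw [← this]
    group
  rw [mul_neg, mul_neg, h, h]
  split_ifs <;> group

/-- The homeomorphism `y ↦ g v y v⁻¹ h⁻¹`, which carries the normal form and the group `AN` to the
given Killing field and the given group. -/
noncomputable def adapted (b : Bool) : SL2Cover ≃ₜ SL2Cover :=
  (conjHomeo (twist b)).trans ((Homeomorph.mulLeft D.g).trans (Homeomorph.mulRight D.h⁻¹))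

theorem adapted_apply (b : Bool) (x : SL2Cover) :
    adapted D b x = D.fromNormal (twist b * x * (twist b)⁻¹) := rfl

theorem adapted_intertwines (b : Bool) : Intertwines D.normal D (adapted D b) := by
  refine ⟨if b then 1 else -1, fun n x => ?_⟩
  rw [adapted_apply, adapted_apply, zAct_fromNormal]
  cases b
  · simp [zAct_weyl_conj]
  · simp

theorem adapted_act (b : Bool) (r : neutral true) (x : SL2Cover) :
    adapted D b (act D.normal r x) = act D (neutralTwist b r) (adapted D b x) := by
  rw [adapted_apply, adapted_apply, act_fromNormal, coe_neutralTwist]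
  cases b
  · simp [act_weyl_conj D r.2]
  · simp

theorem foliatedByOrbits_adapted_iff (b : Bool) (E : Set SL2Cover) :
    FoliatedByOrbits D b (adapted D b '' E) ↔ FoliatedByOrbits D.normal true E := by
  have h1 : neutralTwist b 1 = 1 := Subtype.ext (by simp [coe_neutralTwist])
  refine ⟨fun h => ?_, fun h => h.image _ h1 (adapted_act D b)⟩
  have := h.image (D' := D.normal) (e := (adapted D b).symm) (neutralTwist b).symm
    (by rw [← h1, Homeomorph.symm_apply_apply]) (fun r x => ?_)
  · rwa [Homeomorph.image_symm, Homeomorph.preimage_image] at this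
  · rw [Homeomorph.symm_apply_eq, adapted_act]
    simp

theorem killing_Ad (x : SL2Cover) (X : Matrix (Fin 2) (Fin 2) ℝ) :
    killing (Ad x X) (Ad x X) = killing X X := by
  have h : (x⁻¹.mat : Matrix (Fin 2) (Fin 2) ℝ) * (x.mat : Matrix (Fin 2) (Fin 2) ℝ) = 1 := by
    rw [← Matrix.SpecialLinearGroup.coe_mul]
    simp
  have h2 : Ad x X * Ad x X = (x.mat : Matrix (Fin 2) (Fin 2) ℝ) * (X * X) *
      (x⁻¹.mat : Matrix (Fin 2) (Fin 2) ℝ) := by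
    simp only [Ad]
    calc _ = (x.mat : Matrix (Fin 2) (Fin 2) ℝ) * X *
        ((x⁻¹.mat : Matrix (Fin 2) (Fin 2) ℝ) * (x.mat : Matrix (Fin 2) (Fin 2) ℝ)) * X *
        (x⁻¹.mat : Matrix (Fin 2) (Fin 2) ℝ) := by simp only [Matrix.mul_assoc]
      _ = _ := by rw [h]; simp only [Matrix.mul_assoc, Matrix.one_mul]
  rw [killing, killing, h2, Matrix.trace_mul_comm, ← Matrix.mul_assoc, h, Matrix.one_mul]

theorem Ad_mul (x y : SL2Cover) (X : Matrix (Fin 2) (Fin 2) ℝ) : Ad (x * y) X = Ad x (Ad y X) := by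
  simp only [Ad, mul_inv_rev, mul_mat, Matrix.SpecialLinearGroup.coe_mul, Matrix.mul_assoc]

theorem Ad_one (X : Matrix (Fin 2) (Fin 2) ℝ) : Ad 1 X = X := by
  simp [Ad]

theorem Ad_sub (x : SL2Cover) (X Y : Matrix (Fin 2) (Fin 2) ℝ) :
    Ad x (X - Y) = Ad x X - Ad x Y := by
  simp only [Ad, Matrix.mul_sub, Matrix.sub_mul]

theorem killingVector_fromNormal (x : SL2Cover) :
    D.killingVector (D.fromNormal x) = Ad D.g (D.normal.killingVector x) := by
  simp only [KillingDatum.killingVector, KillingDatum.fromNormal, KillingDatum.normal, Ad_one,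
    Ad_sub, ← Ad_mul]
  simp

theorem Ad_apply (x : SL2Cover) (X : Matrix (Fin 2) (Fin 2) ℝ) :
    Ad x X = !![x.mat 0 0, x.mat 0 1; x.mat 1 0, x.mat 1 1] * X *
      !![x.mat 1 1, -x.mat 0 1; -x.mat 1 0, x.mat 0 0] := by
  rw [Ad]
  congr 1
  · congr 1
    exact Matrix.eta_fin_two _
  · rw [Matrix.eta_fin_two (x⁻¹.mat : Matrix (Fin 2) (Fin 2) ℝ)]
    simp

/-- `Ad x` is an isometry, so the squares contribute `8 m² + 8 m'²`; the cross term is `-16 m m' (a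
d + b c)`, and `a d = 1 + b c`. -/
theorem killing_normal (x : SL2Cover) :
    killing (D.normal.killingVector x) (D.normal.killingVector x) =
      8 * (D.m - D.m') ^ 2 - 32 * D.m * D.m' * (x.mat 0 1 * x.mat 1 0) := by
  have hdet := det_entries x
  simp only [KillingDatum.killingVector, KillingDatum.normal, killing, Ad_apply, H,
    Matrix.trace_fin_two]
  simp [Matrix.mul_apply, Fin.sum_univ_two]
  have h00 : x.mat 0 0 * x.mat 1 1 = 1 + x.mat 0 1 * x.mat 1 0 := by linarith
  generalize x.mat 0 0 = a at *
  generalize x.mat 0 1 = b at *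
  generalize x.mat 1 0 = c at *
  generalize x.mat 1 1 = d at *
  linear_combination (8 * D.m' ^ 2 * (a * d + 1 - b * c) - 16 * D.m * D.m') * h00

theorem adapted_preservesNorm (b : Bool) : PreservesNorm D.normal D (adapted D b) := fun x => by
  rw [adapted_apply, killingVector_fromNormal, killing_Ad, killing_normal, killing_normal]
  cases b
  · rw [twist_false, (weyl_conj_entries x).2.1, (weyl_conj_entries x).2.2.1]
    ring
  · simp

end BHTZ

namespace BHTZ

open SL2Cover

/-! ### Foliations -/

/-- Left multiplication by `AN` is affine on the first Bruhat coordinate, a translation of the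
second, and leaves the third alone. Hence the third coordinate can serve as a transversal of the
orbits. -/
theorem cartan_mul_unip_mul_chart (t q : ℝ) (j : ℤ) (p : ℝ × ℝ × ℝ) :
    cartan t * unip q * chart j p = chart j (Real.exp (2 * t) * (q + p.1), p.2.1 - t, p.2.2) := by
  have h1 := (commute_center_zpow j (cartan t * unip q)).eq
  have h2 : cartan t * unip q * bruhat p =
      bruhat (Real.exp (2 * t) * (q + p.1), p.2.1 - t, p.2.2) := by
    calc _ = cartan t * (unip q * unip p.1) * weyl * cartan p.2.1 * unip p.2.2 := by
          simp only [bruhat, mul_assoc]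
      _ = unip (Real.exp (2 * t) * (q + p.1)) * (cartan t * weyl) * cartan p.2.1 * unip p.2.2 := by
          rw [← unip_add, cartan_mul_unip]
          simp only [mul_assoc]
      _ = unip (Real.exp (2 * t) * (q + p.1)) * weyl * (cartan (-t) * cartan p.2.1) *
          unip p.2.2 := by
          rw [cartan_mul_weyl]
          simp only [mul_assoc]
      _ = _ := by rw [← cartan_add, neg_add_eq_sub, bruhat]
  rw [chart, ← mul_assoc, ← h1, mul_assoc, h2, chart]

theorem chart_mul_cartan (j : ℤ) (p : ℝ × ℝ × ℝ) (t : ℝ) :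
    chart j p * cartan t = chart j (p.1, p.2.1 + t, Real.exp (-(2 * t)) * p.2.2) := by
  have h := cartan_mul_unip t (Real.exp (-(2 * t)) * p.2.2)
  rw [← mul_assoc (Real.exp _), ← Real.exp_add, add_neg_cancel, Real.exp_zero, one_mul] at h
  simp only [chart, bruhat, cartan_add, mul_assoc, h]

theorem chart_mul_unip (j : ℤ) (p : ℝ × ℝ × ℝ) (q : ℝ) :
    chart j p * unip q = chart j (p.1, p.2.1, p.2.2 + q) := by
  simp only [chart, bruhat, unip_add, mul_assoc]

/-- The coordinates of a flow box of the associated action. -/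
noncomputable def boxHomeo (p : ℝ × ℝ × ℝ) (l β κ : ℝ) (hl : l ≠ 0) :
    (ℝ × ℝ) × ℝ ≃ₜ ℝ × ℝ × ℝ where
  toFun v := (Real.exp (2 * v.1.1) * (v.1.2 + p.1), p.2.1 + l * v.1.1,
    Real.exp (β * v.1.1) * (p.2.2 + v.2 + κ * v.1.2))
  invFun y :=
    (((y.2.1 - p.2.1) / l, Real.exp (-(2 * ((y.2.1 - p.2.1) / l))) * y.1 - p.1),
      Real.exp (-(β * ((y.2.1 - p.2.1) / l))) * y.2.2 - p.2.2 -
        κ * (Real.exp (-(2 * ((y.2.1 - p.2.1) / l))) * y.1 - p.1))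
  left_inv v := by
    obtain ⟨⟨t, q⟩, u⟩ := v
    simp only [add_sub_cancel_left, mul_div_cancel_left₀ _ hl, Real.exp_neg,
      inv_mul_cancel_left₀ (Real.exp_ne_zero _)]
    congr 1
    · congr 1
      ring
    · ring
  right_inv y := by
    obtain ⟨s, t, q⟩ := y
    simp only [mul_div_cancel₀ _ hl, Real.exp_neg, sub_add_cancel]
    congr 1
    · rw [mul_inv_cancel_left₀ (Real.exp_ne_zero _)]
    · congr 1
      · ring
      · have h : ∀ a b c : ℝ, a + (b - a - c) + c = b := fun a b c => by ring
        rw [h, mul_inv_cancel_left₀ (Real.exp_ne_zero _)]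
  continuous_toFun := by fun_prop
  continuous_invFun := by fun_prop

theorem foliatedByOrbits_of_boxes {D : KillingDatum} {E : Set SL2Cover}
    (h : ∀ r ∈ neutral true, ∀ x ∈ E, act D r x ∈ E)
    (h' : ∀ x ∈ E, ∃ s : ℝ → SL2Cover, s 0 = x ∧ (∀ u, s u ∈ E) ∧
      IsOpenEmbedding fun p : (ℝ × ℝ) × ℝ => act D (cartan p.1.1 * unip p.1.2) (s p.2)) :
    FoliatedByOrbits D true E := by
  refine ⟨h, fun x hx => ?_⟩
  obtain ⟨s, h0, hs, hemb⟩ := h' x hx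
  refine ⟨univ, s, isOpen_univ, mem_univ _, h0, hs, ?_⟩
  let κ : ((univ : Set (neutral true)) : Type) × ℝ ≃ₜ (ℝ × ℝ) × ℝ :=
    ((Homeomorph.Set.univ _).trans neutralHomeo.symm).prodCongr (Homeomorph.refl ℝ)
  convert hemb.comp κ.isOpenEmbedding using 1
  funext ⟨⟨r, _⟩, u⟩
  simp only [Function.comp, κ, Homeomorph.coe_prodCongr, ← coe_neutralHomeo]
  simp

theorem act_spinless {D : KillingDatum} (hD : D.m = D.m') (t q : ℝ) (x : SL2Cover) :
    act D.normal (cartan t * unip q) x = cartan t * unip q * x * unip q * cartan (-t) := by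
  rw [normal_act, if_pos hD, tau, mul_inv_rev, map_mul, map_inv, map_inv, sigma_unip, sigma_cartan,
    unip_neg, inv_inv, cartan_neg]
  simp only [mul_assoc]

theorem act_spinless_chart {D : KillingDatum} (hD : D.m = D.m') (t q : ℝ) (j : ℤ)
    (p : ℝ × ℝ × ℝ) : act D.normal (cartan t * unip q) (chart j p) =
      chart j (Real.exp (2 * t) * (q + p.1), p.2.1 + -2 * t, Real.exp (2 * t) * (p.2.2 + q)) := by
  rw [act_spinless hD, cartan_mul_unip_mul_chart, chart_mul_unip, chart_mul_cartan]
  ring_nf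

theorem foliatedByOrbits_sheet {D : KillingDatum} (hD : D.m = D.m') (j : ℤ) :
    FoliatedByOrbits D.normal true (sheet j) := by
  rw [← range_chart]
  refine foliatedByOrbits_of_boxes ?_ ?_
  · rintro r hr _ ⟨p, rfl⟩
    obtain ⟨t, q, rfl⟩ := mem_neutral_true.1 hr
    exact ⟨_, (act_spinless_chart hD t q j p).symm⟩
  · rintro _ ⟨p, rfl⟩
    refine ⟨fun u => chart j (p.1, p.2.1, p.2.2 + u), by simp, fun u => ⟨_, rfl⟩, ?_⟩
    -- By `act_spinless_chart` the `A` coordinate moves at rate `-2`, the third coordinate is scaled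
    -- by `exp (2 t)`, and `q` enters it with coefficient `1`.
    convert (isOpenEmbedding_chart j).comp
      (boxHomeo p (-2) 2 1 (by norm_num)).isOpenEmbedding using 1
    funext v
    simp [act_spinless_chart hD, boxHomeo]

/-- The left factor moves the `A` coordinate at rate `-1` and the right factor at rate `β`. The
total rate `β - 1` must be nonzero for `t` to be recovered from that coordinate. -/
theorem isOpenEmbedding_mul_chart_mul {β : ℝ} (hβ : β ≠ 1) (j : ℤ) (p : ℝ × ℝ × ℝ) :
    IsOpenEmbedding fun v : (ℝ × ℝ) × ℝ =>
      cartan v.1.1 * unip v.1.2 * chart j (p.1, p.2.1, p.2.2 + v.2) * cartan (β * v.1.1) := by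
  convert (isOpenEmbedding_chart j).comp
    (boxHomeo p (β - 1) (-(2 * β)) 0 (sub_ne_zero.2 hβ)).isOpenEmbedding using 1
  funext v
  rw [cartan_mul_unip_mul_chart, chart_mul_cartan]
  simp only [Function.comp, boxHomeo, Homeomorph.homeomorph_mk_coe, Equiv.coe_fn_mk]
  ring_nf

theorem foliatedByOrbits_univ_of_lt {D : KillingDatum} (hD : D.m' < D.m) :
    FoliatedByOrbits D.normal true univ := by
  have hact : ∀ t q x, act D.normal (cartan t * unip q) x =
      cartan t * unip q * x * cartan (-(D.m' / D.m) * t) := fun t q x => by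
    rw [normal_act, if_neg hD.ne', if_pos hD, logA_cartan_mul_unip]
  have h0 : 0 < D.m' / D.m := div_pos D.m'_pos D.m_pos
  have h1 : D.m' / D.m < 1 := (div_lt_one D.m_pos).2 hD
  refine foliatedByOrbits_of_boxes (fun _ _ _ _ => mem_univ _) fun x _ => ?_
  by_cases hx : x.mat 1 0 = 0
  -- Points with `c = 0` are moved into a Bruhat cell by right multiplication with `weyl`. Moving
  -- `weyl⁻¹` across the right factor changes the sign of `β`, which becomes `m' / m`; this differs
  -- from `1` because `m' < m`.
  · have hxw : (x * weyl).mat 1 0 ≠ 0 := by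
      rw [mul_entry]
      have := det_entries x
      rw [hx] at this ⊢
      intro h
      simp at h
      simp [h] at this
    obtain ⟨j, hj⟩ := exists_mem_sheet hxw
    rw [← range_chart] at hj
    obtain ⟨p, hp⟩ := hj
    refine ⟨fun u => chart j (p.1, p.2.1, p.2.2 + u) * weyl⁻¹, ?_, fun _ => mem_univ _, ?_⟩
    · simp [hp]
    · convert (Homeomorph.mulRight weyl⁻¹).isOpenEmbedding.comp
        (isOpenEmbedding_mul_chart_mul (β := D.m' / D.m) h1.ne j p) using 1
      funext v
      have h2 := cartan_mul_weyl (D.m' / D.m * v.1.1)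
      have h3 : weyl⁻¹ * cartan (-(D.m' / D.m) * v.1.1) =
          cartan (D.m' / D.m * v.1.1) * weyl⁻¹ := by
        rw [neg_mul, inv_mul_eq_iff_eq_mul, ← mul_assoc, eq_mul_inv_iff_mul_eq, cartan_mul_weyl,
          neg_neg]
      simp only [hact, Function.comp, Homeomorph.coe_mulRight, mul_assoc, h3]
  · obtain ⟨j, hj⟩ := exists_mem_sheet hx
    rw [← range_chart] at hj
    obtain ⟨p, rfl⟩ := hj
    refine ⟨fun u => chart j (p.1, p.2.1, p.2.2 + u), by simp, fun _ => mem_univ _, ?_⟩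
    simp only [hact]
    exact isOpenEmbedding_mul_chart_mul (by linarith) j p

/-- The Killing field obtained by exchanging the two factors. -/
noncomputable def KillingDatum.swap (D : KillingDatum) : KillingDatum :=
  ⟨D.m', D.m, 1, 1, D.m'_pos, D.m_pos⟩

theorem foliatedByOrbits_univ {D : KillingDatum} (hD : D.m ≠ D.m') :
    FoliatedByOrbits D.normal true univ := by
  rcases lt_or_gt_of_ne hD with h | h
  · have h1 := (foliatedByOrbits_univ_of_lt (D := D.swap) h).image (D' := D.normal)
      (e := Homeomorph.inv SL2Cover) (Homeomorph.refl _) rfl (fun r x => ?_)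
    · rwa [image_univ, (Homeomorph.inv SL2Cover).surjective.range_eq] at h1
    · have hs : act D.swap.normal r x = r * x * cartan (-(D.m / D.m') * logA r) := by
        rw [normal_act]
        exact (if_neg hD.symm).trans (if_pos h)
      rw [normal_act D, if_neg hD, if_neg h.not_gt, hs]
      simp only [Homeomorph.coe_inv, mul_inv_rev, Homeomorph.refl_apply, id, mul_assoc, ← cartan_neg,
        neg_mul, neg_neg]
  · exact foliatedByOrbits_univ_of_lt h

/-- In the spinless case the points of the parabolic subgroup lie on orbits of dimension at most
one. -/
theorem FoliatedByOrbits.entry_10_ne_zero {D : KillingDatum} (hD : D.m = D.m') {E : Set SL2Cover}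
    (hE : FoliatedByOrbits D.normal true E) {x : SL2Cover} (hx : x ∈ E) : x.mat 1 0 ≠ 0 := by
  intro h
  obtain ⟨V, s, hV, hV1, rfl, -, hemb⟩ := hE.2 x hx
  obtain ⟨k, hk⟩ : ∃ k : ℤ, theta (s 0) = Real.pi * k := by
    rw [entry_10_eq] at h
    obtain ⟨k, hk⟩ := Real.sin_eq_zero_iff.1 ((mul_eq_zero.1 h).resolve_left (Real.exp_ne_zero _))
    exact ⟨k, by rw [← hk, mul_comm]⟩
  obtain ⟨t₀, q₀, hx0⟩ := exists_eq_center_zpow_mul hk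
  set δ := 1 + Real.exp (-(2 * t₀)) with hδ
  have hδ0 : δ ≠ 0 := by positivity
  -- The solution of `exp (2 t) (exp (-2 t₀) q + q₀ + q) = q₀`, the condition for `cartan t * unip
  -- q` to fix `s 0`. It exists for every `t` since `δ > 0`, so the stabilizer contains a curve
  -- through the identity, and a flow box at `s 0` cannot be injective.
  let q : ℝ → ℝ := fun t => (Real.exp (-(2 * t)) - 1) * q₀ / δ
  have hfix : ∀ t, act D.normal (cartan t * unip (q t)) (s 0) = s 0 := fun t => by
    rw [act_spinless hD, hx0]
    have h1 := (commute_center_zpow k (cartan t * unip (q t))).eq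
    have h2 : unip (q t) * cartan t₀ = cartan t₀ * unip (Real.exp (-(2 * t₀)) * q t) := by
      rw [cartan_mul_unip, ← mul_assoc, ← Real.exp_add, add_neg_cancel, Real.exp_zero, one_mul]
    calc _ = centerGen ^ k * cartan t * (unip (q t) * cartan t₀) * unip q₀ * unip (q t) *
          cartan (-t) := by
          rw [← mul_assoc, ← h1]
          simp only [mul_assoc]
      _ = centerGen ^ k * (cartan t * cartan t₀) *
          (unip (Real.exp (-(2 * t₀)) * q t) * unip q₀ * unip (q t)) * cartan (-t) := by
          rw [h2]
          simp only [mul_assoc]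
      _ = centerGen ^ k * cartan t₀ * (cartan t *
          unip (Real.exp (-(2 * t₀)) * q t + q₀ + q t)) * cartan (-t) := by
          rw [← cartan_add, add_comm t, cartan_add, unip_add, unip_add]
          simp only [mul_assoc]
      _ = centerGen ^ k * cartan t₀ *
          unip (Real.exp (2 * t) * (Real.exp (-(2 * t₀)) * q t + q₀ + q t)) := by
          rw [cartan_mul_unip, cartan_neg]
          simp only [mul_assoc, mul_inv_cancel, mul_one]
      _ = _ := by
          have : Real.exp (2 * t) * (Real.exp (-(2 * t₀)) * q t + q₀ + q t) = q₀ := by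
            have h3 : Real.exp (-(2 * t₀)) * q t + q₀ + q t = Real.exp (-(2 * t)) * q₀ := by
              have : q t * δ = (Real.exp (-(2 * t)) - 1) * q₀ := div_mul_cancel₀ _ hδ0
              rw [hδ] at this
              linarith
            rw [h3, ← mul_assoc, ← Real.exp_add, add_neg_cancel, Real.exp_zero, one_mul]
          rw [this, mul_assoc]
  have hcont : Continuous fun t => neutralHomeo (t, q t) := by
    refine neutralHomeo.continuous.comp ?_
    simp only [q]
    fun_prop
  have h0 : neutralHomeo (0, q 0) = 1 := Subtype.ext (by simp [coe_neutralHomeo, q])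
  have hnhds : {t | neutralHomeo (t, q t) ∈ V} ∈ 𝓝 (0 : ℝ) :=
    hcont.continuousAt.preimage_mem_nhds (by rw [h0]; exact hV.mem_nhds hV1)
  obtain ⟨ε, hε, hball⟩ := Metric.mem_nhds_iff.1 hnhds
  have hmem : neutralHomeo (ε / 2, q (ε / 2)) ∈ V := hball (by
    rw [Metric.mem_ball, Real.dist_eq, sub_zero, abs_of_pos (half_pos hε)]
    exact half_lt_self hε)
  have heq := @hemb.injective (⟨_, hmem⟩, 0) (⟨1, hV1⟩, 0) (by
    simp only [coe_neutralHomeo, hfix]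
    have := hfix 0
    simpa [q] using this.symm)
  have h4 : neutralHomeo (ε / 2, q (ε / 2)) = neutralHomeo (0, q 0) := by
    rw [h0]
    exact congrArg (fun p => p.1.1) heq
  have h5 := congrArg Prod.fst (neutralHomeo.injective h4)
  simp only at h5
  linarith

end BHTZ

namespace BHTZ

open SL2Cover

/-! ### Domains in normal form -/

theorem zAct_entries (D : KillingDatum) (n : ℤ) (x : SL2Cover) :
    (D.normal.zAct n x).mat 0 0 = Real.exp ((D.m - D.m') * n) * x.mat 0 0 ∧
      (D.normal.zAct n x).mat 0 1 = Real.exp ((D.m + D.m') * n) * x.mat 0 1 ∧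
      (D.normal.zAct n x).mat 1 0 = Real.exp (-((D.m + D.m') * n)) * x.mat 1 0 ∧
      (D.normal.zAct n x).mat 1 1 = Real.exp (-((D.m - D.m') * n)) * x.mat 1 1 := by
  rw [normal_zAct]
  simp only [mul_entry]
  simp only [cartan_00, cartan_01, cartan_10, cartan_11]
  refine ⟨?_, ?_, ?_, ?_⟩ <;> simp only [zero_mul, mul_zero, add_zero, zero_add] <;>
    rw [mul_right_comm, ← Real.exp_add] <;> ring_nf

theorem isSimplyConnected_sheet (j : ℤ) : IsSimplyConnected (sheet j) := by
  rw [← range_chart, ← image_univ, (isOpenEmbedding_chart j).isEmbedding.isSimplyConnected_image]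
  exact (Homeomorph.Set.univ _).toHomotopyEquiv.simplyConnectedSpace

theorem zAct_mem_sheet (D : KillingDatum) (n : ℤ) {j : ℤ} {x : SL2Cover} (hx : x ∈ sheet j) :
    D.normal.zAct n x ∈ sheet j := by
  rw [← range_chart] at hx ⊢
  obtain ⟨p, rfl⟩ := hx
  have h := cartan_mul_unip_mul_chart (D.m * n) 0 j p
  rw [unip_zero, mul_one] at h
  rw [normal_zAct, h, chart_mul_cartan]
  exact ⟨_, rfl⟩

/-- The flow contracts the entry `c`, which does not vanish on a sheet, by the exact factor `exp
(-(m + m') n)`. As `Real.log` is the logarithm of the absolute value, the sign of `c` on the sheet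
plays no role. -/
theorem actsProperlyDiscontinuously_sheet (D : KillingDatum) (j : ℤ) {U : Set SL2Cover}
    (hU : U ⊆ sheet j) : ActsProperlyDiscontinuously D.normal.zAct U := by
  have hm := add_pos D.m_pos D.m'_pos
  refine actsProperlyDiscontinuously_of_displacement (F := fun x => Real.log (x.mat 1 0)) hm ?_ ?_
  · exact (continuous_entry 1 0).continuousOn.log fun x hx =>
      entry_10_ne_zero_of_mem_sheet (hU hx)
  · intro n x hx
    rw [(zAct_entries D n x).2.2.1, Real.log_mul (Real.exp_ne_zero _)
      (entry_10_ne_zero_of_mem_sheet (hU hx)), Real.log_exp, add_sub_cancel_right, abs_neg, abs_mul,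
      abs_of_pos hm]

theorem isAdmissible_sheet (D : KillingDatum) (j : ℤ) : IsAdmissible D.normal (sheet j) where
  isOpen := isOpen_sheet j
  simplyConnected := isSimplyConnected_sheet j
  stable n _ hx := zAct_mem_sheet D n hx
  proper := actsProperlyDiscontinuously_sheet D j subset_rfl

/-- In the spinless case the flow is conjugation by `A`, which expands one unipotent direction and
contracts the other. A boundary point `z = centerGen ^ k * a * n` is therefore not separated from
the orbit of `centerGen ^ k * a * n̄`, with `n̄` lower unipotent, which can be taken in the sheet.
No admissible set contains both points. -/
theorem isExtensionDomain_sheet {D : KillingDatum} (hD : D.m = D.m') (j : ℤ) :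
    IsExtensionDomain D.normal (sheet j) := by
  refine ⟨isAdmissible_sheet D j, fun E hE hle => ?_⟩
  by_contra hn
  obtain ⟨x, hx⟩ := (isSimplyConnected_sheet j).nonempty
  obtain ⟨z, hz, hz'⟩ := hE.simplyConnected.isPathConnected.isConnected.isPreconnected.exists_theta_eq
    (hle hx) hx hn
  -- The sign of `s` selects the side of the boundary level: above it at the lower end of the sheet,
  -- below it at the upper end.
  obtain ⟨k, s, hk, hs⟩ : ∃ (k : ℤ) (s : ℝ), theta z = Real.pi * k ∧
      ∀ t, centerGen ^ k * (cartan t * lowerUnip s) ∈ sheet j := by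
    rcases hz' with h | h
    · refine ⟨j, 1, h, fun t => ?_⟩
      rw [sheet, mem_preimage, theta_center_zpow_mul, theta_cartan_mul]
      have := theta_lowerUnip_one
      constructor <;> linarith [this.1, this.2]
    · refine ⟨j + 1, -1, by exact_mod_cast h, fun t => ?_⟩
      rw [sheet, mem_preimage, theta_center_zpow_mul, theta_cartan_mul]
      have := theta_lowerUnip_neg_one
      push_cast
      constructor <;> linarith [this.1, this.2]
  obtain ⟨t, q, rfl⟩ := exists_eq_center_zpow_mul hk
  -- The factor by which conjugation by `cartan (-(m n))` contracts the upper unipotents; the lower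
  -- ones are expanded by its inverse. So `z * lowerUnip (ε n * s)` tends to `z`, while its image at
  -- time `-n` has lower unipotent factor `lowerUnip s` and an upper one tending to the identity.
  let ε : ℕ → ℝ := fun n => Real.exp (-(2 * (D.m * n)))
  have hε : Filter.Tendsto ε Filter.atTop (𝓝 0) := by
    refine Real.tendsto_exp_neg_atTop_nhds_zero.comp ?_
    have h2m : (0 : ℝ) < 2 * D.m := by linarith [D.m_pos]
    have := tendsto_natCast_atTop_atTop (R := ℝ) |>.const_mul_atTop h2m
    simpa only [mul_assoc] using this
  have hl : Continuous lowerUnip :=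
    (continuous_const.mul (continuous_unip.comp continuous_neg)).mul continuous_const
  have hu := continuous_unip
  have t1 : Filter.Tendsto (fun n => centerGen ^ k * (cartan t * unip q) * lowerUnip (ε n * s))
      Filter.atTop (𝓝 (centerGen ^ k * (cartan t * unip q))) := by
    have h : Continuous fun e => centerGen ^ k * (cartan t * unip q) * lowerUnip (e * s) := by fun_prop
    simpa [Function.comp_def, lowerUnip] using (h.tendsto 0).comp hε
  have t2 : Filter.Tendsto (fun n => centerGen ^ k * (cartan t * (unip (ε n * q) * lowerUnip s)))
      Filter.atTop (𝓝 (centerGen ^ k * (cartan t * lowerUnip s))) := by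
    have h : Continuous fun e => centerGen ^ k * (cartan t * (unip (e * q) * lowerUnip s)) := by
      fun_prop
    simpa [Function.comp_def] using (h.tendsto 0).comp hε
  refine hE.proper.false_of_tendsto hE.isOpen (k := fun n : ℕ => -(n : ℤ)) (fun a b => by simp)
    (hle (hs t)) hz t1 (t2.congr fun n => ?_)
  have hc := (commute_center_zpow k (cartan (-(D.m * n)))).eq
  have h1 : cartan (-(D.m * n)) * unip q = unip (ε n * q) * cartan (-(D.m * n)) := by
    rw [cartan_mul_unip]
    simp only [ε, mul_neg]
  have h2 : cartan (-(D.m * n)) * lowerUnip (ε n * s) = lowerUnip s * cartan (-(D.m * n)) := by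
    rw [cartan_mul_lowerUnip, ← mul_assoc, ← Real.exp_add]
    simp
  rw [normal_zAct, ← hD]
  push_cast
  rw [mul_neg, neg_neg]
  calc _ = centerGen ^ k * cartan t * (unip (ε n * q) * (lowerUnip s * cartan (-(D.m * n)))) *
        cartan (D.m * n) := by
        rw [cartan_neg]
        simp only [mul_assoc, inv_mul_cancel, mul_one]
    _ = centerGen ^ k * cartan t * (unip (ε n * q) * cartan (-(D.m * n)) * lowerUnip (ε n * s)) *
        cartan (D.m * n) := by
        rw [← h2]
        simp only [mul_assoc]
    _ = centerGen ^ k * (cartan (-(D.m * n)) * cartan t) * unip q * lowerUnip (ε n * s) *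
        cartan (D.m * n) := by
        rw [← h1, ← cartan_add, add_comm, cartan_add]
        simp only [mul_assoc]
    _ = _ := by
        rw [← mul_assoc, hc]
        simp only [mul_assoc]

theorem eq_sheet_of_foliatedByOrbits {D : KillingDatum} (hD : D.m = D.m') {j : ℤ}
    {E : Set SL2Cover} (hE : IsExtensionDomain D.normal E)
    (hf : FoliatedByOrbits D.normal true E) {x : SL2Cover} (hx : x ∈ E) (hj : x ∈ sheet j) :
    E = sheet j :=
  hE.eq_of_subset (isAdmissible_sheet D j)
    (hE.1.simplyConnected.isPathConnected.isConnected.isPreconnected.subset_sheet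
      (fun _ => hf.entry_10_ne_zero hD) hx hj)

/-- The components of the open set where the spinless Killing field is spacelike. -/
def wedge (j : ℤ) : Set SL2Cover := sheet j ∩ {x | x.mat 0 1 * x.mat 1 0 < 0}

/-! ### The spacelike wedges in Bruhat coordinates. -/

theorem chart_entries_mul (j : ℤ) (p : ℝ × ℝ × ℝ) :
    (chart j p).mat 0 1 * (chart j p).mat 1 0 =
      (p.1 * Real.exp p.2.1) * (Real.exp p.2.1 * p.2.2) - 1 := by
  have h := det_entries (bruhat p)
  rw [bruhat_00, bruhat_11] at h
  simp only [chart, center_zpow_mul_entry]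
  have h1 : ((-1 : ℝ) ^ j) * ((-1 : ℝ) ^ j) = 1 := by
    rw [← zpow_add₀ (by norm_num)]
    exact (Even.add_self j).neg_one_zpow
  linear_combination ((bruhat p).mat 0 1 * (bruhat p).mat 1 0) * h1 - h

/-- Since `b c = a d - 1`, the condition is `a d < 1`. Rescaling the outer Bruhat coordinates by the
exponential of the middle one makes it `p.1 * p.2.2 < 1`, a set star-shaped about the origin. -/
theorem isSimplyConnected_wedge (j : ℤ) : IsSimplyConnected (wedge j) := by
  let h : ℝ × ℝ × ℝ ≃ₜ ℝ × ℝ × ℝ :=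
    { toFun := fun p => (p.1 * Real.exp (-p.2.1), p.2.1, Real.exp (-p.2.1) * p.2.2)
      invFun := fun p => (p.1 * Real.exp p.2.1, p.2.1, Real.exp p.2.1 * p.2.2)
      left_inv := fun p => by
        simp only [mul_assoc, ← Real.exp_add, ← mul_assoc (Real.exp _)]
        simp
      right_inv := fun p => by
        simp only [mul_assoc, ← Real.exp_add, ← mul_assoc (Real.exp _)]
        simp
      continuous_toFun := by fun_prop
      continuous_invFun := by fun_prop }
  let C : Set (ℝ × ℝ × ℝ) := {p | p.1 * p.2.2 < 1}
  have hC : StarConvex ℝ 0 C := by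
    rw [starConvex_zero_iff]
    intro p hp a ha ha1
    change (a * p.1) * (a * p.2.2) < 1
    have hp' : p.1 * p.2.2 < 1 := hp
    have h2 : a * a ≤ 1 := by nlinarith
    rcases le_or_gt (p.1 * p.2.2) 0 with h3 | h3
    · nlinarith [mul_nonneg ha ha]
    · nlinarith
  have : ContractibleSpace C := hC.contractibleSpace ⟨0, by simp [C]⟩
  have hw : wedge j = chart j '' (h '' C) := by
    ext x
    constructor
    · rintro ⟨hx, hx'⟩
      rw [← range_chart] at hx
      obtain ⟨p, rfl⟩ := hx
      rw [mem_ofPred_eq, chart_entries_mul] at hx'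
      refine ⟨p, ⟨h.symm p, ?_, h.apply_symm_apply p⟩, rfl⟩
      change (p.1 * Real.exp p.2.1) * (Real.exp p.2.1 * p.2.2) < 1
      linarith
    · rintro ⟨_, ⟨p, hp, rfl⟩, rfl⟩
      refine ⟨range_chart j ▸ mem_range_self _, ?_⟩
      have hp' : p.1 * p.2.2 < 1 := hp
      rw [mem_ofPred_eq, chart_entries_mul]
      have h1 : (h.symm (h p)) = p := h.symm_apply_apply p
      have h2 : ((h p).1 * Real.exp (h p).2.1) * (Real.exp (h p).2.1 * (h p).2.2) =
          (h.symm (h p)).1 * (h.symm (h p)).2.2 := rfl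
      rw [h2, h1]
      linarith
  rw [hw, (isOpenEmbedding_chart j).isEmbedding.isSimplyConnected_image,
    h.isSimplyConnected_image]
  exact SimplyConnectedSpace.ofContractible C

theorem isAdmissible_wedge (D : KillingDatum) (j : ℤ) : IsAdmissible D.normal (wedge j) where
  isOpen := (isOpen_sheet j).inter
    (isOpen_lt ((continuous_entry 0 1).mul (continuous_entry 1 0)) continuous_const)
  simplyConnected := isSimplyConnected_wedge j
  stable n x hx := by
    refine ⟨zAct_mem_sheet D n hx.1, ?_⟩
    rw [mem_ofPred_eq, (zAct_entries D n x).2.1, (zAct_entries D n x).2.2.1, mul_mul_mul_comm,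
      ← Real.exp_add, add_neg_cancel, Real.exp_zero, one_mul]
    exact hx.2
  proper := actsProperlyDiscontinuously_sheet D j inter_subset_left

theorem spacelike_iff {D : KillingDatum} (hD : D.m = D.m') (x : SL2Cover) :
    0 < killing (D.normal.killingVector x) (D.normal.killingVector x) ↔
      x.mat 0 1 * x.mat 1 0 < 0 := by
  have h : 0 < D.m' * D.m' := mul_pos D.m'_pos D.m'_pos
  rw [killing_normal, hD]
  constructor
  · intro h'
    by_contra! h1
    nlinarith [mul_nonneg h.le h1]
  · intro h1
    nlinarith [mul_neg_of_pos_of_neg h h1]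

/-- Spacelike points have `b c < 0`, in particular `c ≠ 0`, so a connected spacelike set lies in one
sheet, hence in its wedge. The wedge being admissible and spacelike, maximality gives equality. -/
theorem IsBHTZDomain.exists_eq_wedge {D : KillingDatum} (hD : D.m = D.m') {U : Set SL2Cover}
    (hU : IsBHTZDomain D.normal U) : ∃ j, U = wedge j := by
  obtain ⟨⟨hadm, hpos⟩, -⟩ := id hU
  obtain ⟨x, hx⟩ := hadm.simplyConnected.nonempty
  have h10 : ∀ y ∈ U, y.mat 1 0 ≠ 0 := fun y hy h => by
    have := (spacelike_iff hD y).1 (hpos y hy)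
    simp [h] at this
  obtain ⟨j, hj⟩ := exists_mem_sheet (h10 x hx)
  refine ⟨j, hU.eq_of_subset ⟨isAdmissible_wedge D j, fun y hy => (spacelike_iff hD y).2 hy.2⟩ ?_⟩
  exact fun y hy => ⟨hadm.simplyConnected.isPathConnected.isConnected.isPreconnected.subset_sheet
    h10 hx hj hy, (spacelike_iff hD y).1 (hpos y hy)⟩

theorem centerGen_zpow_mul_weyl_mem_wedge (j : ℤ) : centerGen ^ j * weyl ∈ wedge j := by
  have h : centerGen ^ j * weyl = chart j (0, 0, 0) := by simp [chart, bruhat]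
  rw [h]
  refine ⟨range_chart j ▸ mem_range_self _, ?_⟩
  rw [mem_ofPred_eq, chart_entries_mul]
  simp

/-- A base point of `wedge j` fixed by the conjugation between the two parabolic groups; it allows
the sheet indices obtained for the two groups to be compared. -/
theorem twist_conj_fixed (b : Bool) (j : ℤ) :
    twist b * (centerGen ^ j * weyl) * (twist b)⁻¹ = centerGen ^ j * weyl := by
  rw [← mul_assoc (twist b), ← (commute_center_zpow j (twist b)).eq]
  cases b
  · simp [mul_assoc]
  · simp

/-! ### The rotating case: properness on the whole group. -/

theorem mul_lower_bound {A B a b k : ℝ} (hA : 0 ≤ A) (hB : 0 ≤ B) (hAB : 0 < A + B)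
    (ha : k ≤ a) (hb : k ≤ b) :
    k + Real.log (A + B) ≤ Real.log (Real.exp a * A + Real.exp b * B) := by
  have hpos : 0 < Real.exp k * (A + B) := mul_pos (Real.exp_pos _) hAB
  rw [← Real.log_exp k, ← Real.log_mul (Real.exp_ne_zero _) hAB.ne']
  refine Real.log_le_log hpos ?_
  rw [mul_add]
  gcongr

/-- The top row of a matrix of determinant `1` is never zero, and for `m' < m` both its entries are
expanded, with exponents `m - m'` and `m + m'`. Hence `log (a² + b²)` grows by at least `2 (m - m')
n` in time `n ≥ 0`. -/
theorem isAdmissible_univ_of_lt {D : KillingDatum} (hD : D.m' < D.m) :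
    IsAdmissible D.normal univ where
  isOpen := isOpen_univ
  simplyConnected := (Homeomorph.Set.univ SL2Cover).toHomotopyEquiv.simplyConnectedSpace
  stable _ _ _ := mem_univ _
  proper := by
    have hk : 0 < D.m - D.m' := sub_pos.2 hD
    have hk' : D.m - D.m' ≤ D.m + D.m' := by linarith [D.m'_pos]
    have hP : ∀ x : SL2Cover, 0 < x.mat 0 0 ^ 2 + x.mat 0 1 ^ 2 := fun x => by
      by_contra! h
      have h1 : x.mat 0 0 = 0 := by nlinarith [sq_nonneg (x.mat 0 0), sq_nonneg (x.mat 0 1)]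
      have h2 : x.mat 0 1 = 0 := by nlinarith [sq_nonneg (x.mat 0 0), sq_nonneg (x.mat 0 1)]
      have := det_entries x
      simp [h1, h2] at this
    have hbound : ∀ n : ℕ, ∀ x : SL2Cover, 2 * (D.m - D.m') * n +
        Real.log (x.mat 0 0 ^ 2 + x.mat 0 1 ^ 2) ≤
        Real.log ((D.normal.zAct n x).mat 0 0 ^ 2 + (D.normal.zAct n x).mat 0 1 ^ 2) := by
      intro n x
      rw [(zAct_entries D n x).1, (zAct_entries D n x).2.1, mul_pow, mul_pow, ← Real.exp_nat_mul,
        ← Real.exp_nat_mul]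
      refine mul_lower_bound (sq_nonneg _) (sq_nonneg _) (hP x) ?_ ?_
      · push_cast
        linarith
      · push_cast
        nlinarith [mul_le_mul_of_nonneg_right hk' n.cast_nonneg]
    have hcancel : ∀ (n : ℤ) x, D.normal.zAct (-n) (D.normal.zAct n x) = x := fun n x => by
      rw [normal_zAct, normal_zAct]
      push_cast
      simp only [mul_neg, cartan_neg]
      group
    refine actsProperlyDiscontinuously_of_displacement
      (F := fun x => Real.log (x.mat 0 0 ^ 2 + x.mat 0 1 ^ 2))
      (c := 2 * (D.m - D.m')) (by linarith) ?_ ?_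
    · refine Continuous.continuousOn (Continuous.log ?_ fun x => (hP x).ne')
      exact ((continuous_entry 0 0).pow 2).add ((continuous_entry 0 1).pow 2)
    · intro n x _
      obtain ⟨k, rfl | rfl⟩ := n.eq_nat_or_neg
      · refine le_trans ?_ (le_abs_self _)
        have := hbound k x
        rw [abs_of_nonneg (by positivity)]
        push_cast
        linarith
      · refine le_trans ?_ (neg_le_abs _)
        -- Negative times follow from the positive estimate, applied at the endpoint of the orbit
        -- segment.
        have h1 := hbound k (D.normal.zAct (-k) x)
        have h2 := hcancel (-k) x
        rw [neg_neg] at h2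
        rw [h2] at h1
        push_cast
        rw [abs_neg, abs_of_nonneg (by positivity)]
        linarith

theorem isAdmissible_univ {D : KillingDatum} (hD : D.m ≠ D.m') : IsAdmissible D.normal univ := by
  rcases lt_or_gt_of_ne hD with h | h
  · have h1 := (isAdmissible_univ_of_lt (D := D.swap) h).image (D' := D.normal)
      (e := Homeomorph.inv SL2Cover) ⟨1, fun n x => ?_⟩
    · rwa [image_univ, (Homeomorph.inv SL2Cover).surjective.range_eq] at h1
    · rw [normal_zAct, normal_zAct]
      simp only [Homeomorph.coe_inv, mul_inv_rev, ← cartan_neg, KillingDatum.swap, mul_assoc,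
        neg_neg, Units.val_one, one_mul]
  · exact isAdmissible_univ_of_lt h

end BHTZ

namespace BHTZ

open SL2Cover

variable {D : KillingDatum}

/-! ### Extension domains -/

/-- The index does not depend on `b`: the base point `centerGen ^ j * weyl` has the same image under
both maps `adapted D b`, and a point lies in at most one sheet. -/
theorem IsBHTZDomain.exists_eq_image_wedge (hD : D.m = D.m') {U : Set SL2Cover}
    (hU : IsBHTZDomain D U) : ∃ j, ∀ b, U = adapted D b '' wedge j := by
  have h : ∀ b, ∃ j, U = adapted D b '' wedge j := fun b => by
    obtain ⟨j, hj⟩ := (hU.image (adapted_intertwines D b).symm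
      (adapted_preservesNorm D b).symm).exists_eq_wedge hD
    refine ⟨j, ?_⟩
    rw [← hj, Homeomorph.image_symm, Homeomorph.image_preimage]
  choose j hj using h
  refine ⟨j true, fun b => ?_⟩
  have h1 : adapted D true (centerGen ^ j true * weyl) ∈ U := by
    have h3 := mem_image_of_mem (adapted D true) (centerGen_zpow_mul_weyl_mem_wedge (j true))
    rwa [← hj true] at h3
  have h2 : adapted D true (centerGen ^ j true * weyl) =
      adapted D b (centerGen ^ j true * weyl) := by
    rw [adapted_apply, adapted_apply, twist_conj_fixed, twist_conj_fixed]
  rw [h2, hj b, (adapted D b).injective.mem_set_image] at h1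
  rw [sheet_injective (centerGen_zpow_mul_weyl_mem_wedge (j true)).1 h1.1]
  exact hj b

theorem eq_image_sheet (hD : D.m = D.m') {b : Bool} {j : ℤ} {E : Set SL2Cover}
    (hE : IsExtensionDomain D E) (hf : FoliatedByOrbits D b E) {x : SL2Cover}
    (hx : adapted D b x ∈ E) (hj : x ∈ sheet j) : E = adapted D b '' sheet j := by
  have h : adapted D b '' ((adapted D b).symm '' E) = E := by
    rw [Homeomorph.image_symm, Homeomorph.image_preimage]
  have h1 := hE.image (adapted_intertwines D b).symm
  rw [← h, foliatedByOrbits_adapted_iff] at hf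
  rw [← eq_sheet_of_foliatedByOrbits hD h1 hf (x := x) ⟨_, hx, by simp⟩ hj, h]

theorem IsExtensionDomain.eq_univ (hD : D.m ≠ D.m') {E : Set SL2Cover}
    (hE : IsExtensionDomain D E) : E = univ := by
  have h := (isAdmissible_univ hD).image (adapted_intertwines D true)
  rw [image_univ, (adapted D true).surjective.range_eq] at h
  exact hE.eq_of_subset h (subset_univ _)

theorem isExtensionDomain_univ (hD : D.m ≠ D.m') : IsExtensionDomain D univ := by
  have h := (isAdmissible_univ hD).image (adapted_intertwines D true)
  rw [image_univ, (adapted D true).surjective.range_eq] at h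
  exact ⟨h, fun _ _ _ => subset_univ _⟩

theorem existsUnique_extensionDomain {U : Set SL2Cover} (hU : IsBHTZDomain D U) (b : Bool) :
    ∃! E : Set SL2Cover, IsExtensionDomain D E ∧ U ⊆ E ∧ FoliatedByOrbits D b E := by
  by_cases hD : D.m = D.m'
  · obtain ⟨j, hj⟩ := hU.exists_eq_image_wedge hD
    refine ⟨adapted D b '' sheet j, ⟨(isExtensionDomain_sheet hD j).image
      (adapted_intertwines D b), ?_, (foliatedByOrbits_adapted_iff D b _).2
      (foliatedByOrbits_sheet hD j)⟩, ?_⟩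
    · rw [hj b]
      exact image_mono inter_subset_left
    · rintro E ⟨hE, hUE, hf⟩
      have h1 := centerGen_zpow_mul_weyl_mem_wedge j
      refine eq_image_sheet hD hE hf (hUE ?_) h1.1
      rw [hj b]
      exact mem_image_of_mem _ h1
  · refine ⟨univ, ⟨isExtensionDomain_univ hD, subset_univ _, ?_⟩, fun E hE => hE.1.eq_univ hD⟩
    have h := (foliatedByOrbits_adapted_iff D b _).2 (foliatedByOrbits_univ hD)
    rwa [image_univ, (adapted D b).surjective.range_eq] at h

/-- The two identifications with the normal form differ by the conjugation that part 2 asks for. -/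
theorem conjugation_adapted (b b' : Bool) (x : SL2Cover) :
    conjugation D (twist b' * (twist b)⁻¹) (adapted D b x) = adapted D b' x := by
  rw [conjugation, adapted_apply, adapted_apply, toNormal_fromNormal]
  group

theorem conjugateOver_of_foliatedByOrbits {U E E' : Set SL2Cover} (hU : IsBHTZDomain D U)
    {b b' : Bool} (hE : IsExtensionDomain D E) (hUE : U ⊆ E) (hf : FoliatedByOrbits D b E)
    (hE' : IsExtensionDomain D E') (hUE' : U ⊆ E') (hf' : FoliatedByOrbits D b' E') :
    ConjugateOver D U E E' := by
  by_cases hD : D.m = D.m'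
  · obtain ⟨j, hj⟩ := hU.exists_eq_image_wedge hD
    have h1 := centerGen_zpow_mul_weyl_mem_wedge j
    have hmem : ∀ b, adapted D b (centerGen ^ j * weyl) ∈ U := fun b => by
      rw [hj b]
      exact mem_image_of_mem _ h1
    rw [eq_image_sheet hD hE hf (hUE (hmem b)) h1.1,
      eq_image_sheet hD hE' hf' (hUE' (hmem b')) h1.1]
    -- Both `U` and the extension domains are images, with the same index `j`, of `wedge j` and
    -- `sheet j`; exchanging the identifications thus preserves `U` and carries `E` to `E'`. The
    -- time sign is the product of the signs of the two identifications.
    refine ⟨twist b' * (twist b)⁻¹, ?_, ?_, ?_⟩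
    · obtain ⟨ε, hε⟩ := (adapted_intertwines D b).symm
      obtain ⟨ε', hε'⟩ := adapted_intertwines D b'
      refine ⟨ε' * ε, fun n x => ?_⟩
      obtain ⟨y, rfl⟩ := (adapted D b).surjective x
      have h2 := hε n (adapted D b y)
      rw [Homeomorph.symm_apply_apply, Homeomorph.symm_apply_eq] at h2
      rw [h2, conjugation_adapted, conjugation_adapted, hε', ← mul_assoc]
      rfl
    · conv_lhs => rw [hj b]
      rw [image_image]
      simp only [conjugation_adapted]
      exact (hj b').symm
    · rw [image_image]
      simp only [conjugation_adapted]
  · have hid : ∀ x, conjugation D 1 x = x := fun x => by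
      simp only [conjugation, KillingDatum.fromNormal, KillingDatum.toNormal]
      group
    rw [hE.eq_univ hD, hE'.eq_univ hD]
    exact ⟨1, ⟨1, fun n x => by simp [hid]⟩, by simp [hid], by simp [hid]⟩

/-! ### The adjoint orbit -/

theorem Ad_entries (x : SL2Cover) (ξ : Matrix (Fin 2) (Fin 2) ℝ) :
    Ad x ξ 0 0 = (x.mat 0 0 * ξ 0 0 + x.mat 0 1 * ξ 1 0) * x.mat 1 1 -
        (x.mat 0 0 * ξ 0 1 + x.mat 0 1 * ξ 1 1) * x.mat 1 0 ∧
      Ad x ξ 0 1 = (x.mat 0 0 * ξ 0 1 + x.mat 0 1 * ξ 1 1) * x.mat 0 0 -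
        (x.mat 0 0 * ξ 0 0 + x.mat 0 1 * ξ 1 0) * x.mat 0 1 ∧
      Ad x ξ 1 0 = (x.mat 1 0 * ξ 0 0 + x.mat 1 1 * ξ 1 0) * x.mat 1 1 -
        (x.mat 1 0 * ξ 0 1 + x.mat 1 1 * ξ 1 1) * x.mat 1 0 ∧
      Ad x ξ 1 1 = (x.mat 1 0 * ξ 0 1 + x.mat 1 1 * ξ 1 1) * x.mat 0 0 -
        (x.mat 1 0 * ξ 0 0 + x.mat 1 1 * ξ 1 0) * x.mat 0 1 := by
  rw [Ad_apply]
  conv => rw [Matrix.eta_fin_two ξ]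
  simp only [Matrix.mul_fin_two, Matrix.of_apply, Matrix.cons_val', Matrix.cons_val_zero,
    Matrix.cons_val_one, Matrix.cons_val_fin_one]
  refine ⟨?_, ?_, ?_, ?_⟩ <;> ring

theorem Ad_H_entries (x : SL2Cover) :
    Ad x H 0 0 = x.mat 0 0 * x.mat 1 1 + x.mat 0 1 * x.mat 1 0 ∧
      Ad x H 0 1 = -(2 * x.mat 0 0 * x.mat 0 1) ∧ Ad x H 1 0 = 2 * x.mat 1 0 * x.mat 1 1 ∧
      Ad x H 1 1 = -(x.mat 0 0 * x.mat 1 1 + x.mat 0 1 * x.mat 1 0) := by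
  rw [Ad_apply, H]
  simp [Matrix.mul_apply, Fin.sum_univ_two]
  refine ⟨?_, ?_, ?_⟩ <;> ring

theorem Ad_mem_adjointOrbit (x : SL2Cover) {ξ : Matrix (Fin 2) (Fin 2) ℝ}
    (hξ : ξ ∈ adjointOrbit) : Ad x ξ ∈ adjointOrbit := by
  obtain ⟨k, rfl⟩ := hξ
  exact ⟨x * k, Ad_mul x k H⟩

theorem adjointOrbit_entries {ξ : Matrix (Fin 2) (Fin 2) ℝ} (hξ : ξ ∈ adjointOrbit) :
    ξ 1 1 = -ξ 0 0 ∧ ξ 0 0 * ξ 0 0 + ξ 0 1 * ξ 1 0 = 1 := by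
  obtain ⟨x, rfl⟩ := hξ
  obtain ⟨h1, h2, h3, h4⟩ := Ad_H_entries x
  have hdet := det_entries x
  simp only [h1, h2, h3, h4, true_and]
  linear_combination (x.mat 0 0 * x.mat 1 1 - x.mat 0 1 * x.mat 1 0 + 1) * hdet

/-- The orbit lies in the quadric `ξ₀₀² + ξ₀₁ ξ₁₀ = 1` of traceless matrices, on which `ξ₀₁` is
determined once `ξ₁₀ ≠ 0`. -/
theorem adjointOrbit_ext {ξ η : Matrix (Fin 2) (Fin 2) ℝ} (hξ : ξ ∈ adjointOrbit)
    (hη : η ∈ adjointOrbit) (h0 : ξ 1 0 ≠ 0) (h00 : ξ 0 0 = η 0 0) (h10 : ξ 1 0 = η 1 0) :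
    ξ = η := by
  obtain ⟨h1, h2⟩ := adjointOrbit_entries hξ
  obtain ⟨h3, h4⟩ := adjointOrbit_entries hη
  have h01 : ξ 0 1 = η 0 1 := by
    apply mul_right_cancel₀ h0
    rw [← h00, ← h10] at h4
    linarith
  have h11 : ξ 1 1 = η 1 1 := by rw [h1, h3, h00]
  ext i k
  fin_cases i <;> fin_cases k <;> assumption

/-- In the coordinates `(ξ₀₀, ξ₁₀)` the parameter `q` translates by a multiple of `ξ₁₀` and `t`
rescales `ξ₁₀` by a positive factor. Transitivity on each side of the wall `ξ₁₀ = 0` and triviality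
of stabilizers can be read off. -/
theorem Ad_AN_entries (t q : ℝ) (ξ : Matrix (Fin 2) (Fin 2) ℝ) :
    Ad (cartan t * unip q) ξ 0 0 = ξ 0 0 + q * ξ 1 0 ∧
      Ad (cartan t * unip q) ξ 1 0 = Real.exp (-(2 * t)) * ξ 1 0 := by
  rw [(Ad_entries _ _).1, (Ad_entries _ _).2.2.1]
  simp only [mul_entry]
  simp
  have h : Real.exp t * Real.exp (-t) = 1 := by rw [← Real.exp_add]; simp
  constructor
  · linear_combination (ξ 0 0 + q * ξ 1 0) * h
  · rw [mul_right_comm, ← Real.exp_add]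
    ring_nf

theorem continuous_Ad (ξ : Matrix (Fin 2) (Fin 2) ℝ) : Continuous fun x => Ad x ξ := by
  have h1 : Continuous fun x : SL2Cover => (x.mat : Matrix (Fin 2) (Fin 2) ℝ) :=
    continuous_subtype_val.comp continuous_mat
  exact (h1.mul continuous_const).mul (h1.comp continuous_inv)

/-- The coordinate on `sl(2, ℝ)` which vanishes on the orthogonal of the Lie algebra of the
unipotent radical. -/
noncomputable def nilCoord (b : Bool) (ξ : Matrix (Fin 2) (Fin 2) ℝ) : ℝ := Ad (twist b)⁻¹ ξ 1 0

theorem nilCoord_true (ξ : Matrix (Fin 2) (Fin 2) ℝ) : nilCoord true ξ = ξ 1 0 := by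
  simp [nilCoord, Ad_one]

theorem nilCoord_false (ξ : Matrix (Fin 2) (Fin 2) ℝ) : nilCoord false ξ = -ξ 0 1 := by
  rw [nilCoord, (Ad_entries _ _).2.2.1]
  simp

theorem continuous_nilCoord (b : Bool) : Continuous (nilCoord b) := by
  cases b
  · simp only [funext nilCoord_false]
    fun_prop
  · simp only [funext nilCoord_true]
    fun_prop

theorem nilCoord_Ad_twist (b : Bool) (ξ : Matrix (Fin 2) (Fin 2) ℝ) :
    nilCoord b (Ad (twist b) ξ) = ξ 1 0 := by
  rw [nilCoord, ← Ad_mul, inv_mul_cancel, Ad_one]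

theorem Ad_twist_Ad_twist_inv (b : Bool) (ξ : Matrix (Fin 2) (Fin 2) ℝ) :
    Ad (twist b) (Ad (twist b)⁻¹ ξ) = ξ := by
  rw [← Ad_mul, mul_inv_cancel, Ad_one]

theorem mem_neutral {b : Bool} {r : SL2Cover} :
    r ∈ neutral b ↔ ∃ t q, r = twist b * (cartan t * unip q) * (twist b)⁻¹ := by
  rw [← SetLike.mem_coe, ← image_conjHomeo_neutral]
  simp only [mem_image, SetLike.mem_coe, mem_neutral_true, conjHomeo_apply]
  constructor
  · rintro ⟨_, ⟨t, q, rfl⟩, rfl⟩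
    exact ⟨t, q, rfl⟩
  · rintro ⟨t, q, rfl⟩
    exact ⟨_, ⟨t, q, rfl⟩, rfl⟩

theorem Ad_twist_conj (b : Bool) (r : SL2Cover) (ξ : Matrix (Fin 2) (Fin 2) ℝ) :
    Ad (twist b)⁻¹ (Ad (twist b * r * (twist b)⁻¹) ξ) = Ad r (Ad (twist b)⁻¹ ξ) := by
  rw [← Ad_mul, ← Ad_mul]
  group

theorem nilCoord_Ad_neutral {b : Bool} {r : SL2Cover} (hr : r ∈ neutral b)
    (ξ : Matrix (Fin 2) (Fin 2) ℝ) : ∃ c, 0 < c ∧ nilCoord b (Ad r ξ) = c * nilCoord b ξ := by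
  obtain ⟨t, q, rfl⟩ := mem_neutral.1 hr
  refine ⟨_, Real.exp_pos (-(2 * t)), ?_⟩
  rw [nilCoord, Ad_twist_conj, (Ad_AN_entries t q _).2, nilCoord]

theorem exists_neutral_Ad_eq {b : Bool} {ξ η : Matrix (Fin 2) (Fin 2) ℝ} (hξ : ξ ∈ adjointOrbit)
    (hη : η ∈ adjointOrbit) (h : 0 < nilCoord b ξ * nilCoord b η) :
    ∃ r ∈ neutral b, η = Ad r ξ := by
  have h0 : nilCoord b ξ ≠ 0 := left_ne_zero_of_mul h.ne'
  have h0' : nilCoord b η ≠ 0 := right_ne_zero_of_mul h.ne'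
  have hpos : 0 < nilCoord b η / nilCoord b ξ := by
    rw [← mul_div_mul_left _ _ h0]
    exact div_pos h (mul_self_pos.2 h0)
  set ξ' := Ad (twist b)⁻¹ ξ
  set η' := Ad (twist b)⁻¹ η
  -- The scaling `exp (-(2 * t))` must be the ratio of the two values of `nilCoord b`, positive by
  -- hypothesis; then `q` corrects the diagonal entry.
  set t := -(Real.log (nilCoord b η / nilCoord b ξ) / 2) with ht
  set q := (η' 0 0 - ξ' 0 0) / nilCoord b ξ with hq
  refine ⟨_, mem_neutral.2 ⟨t, q, rfl⟩, ?_⟩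
  have key : η' = Ad (cartan t * unip q) ξ' := by
    refine adjointOrbit_ext (Ad_mem_adjointOrbit _ hη)
      (Ad_mem_adjointOrbit _ (Ad_mem_adjointOrbit _ hξ)) h0' ?_ ?_
    · rw [(Ad_AN_entries t q ξ').1]
      change _ = _ + q * nilCoord b ξ
      rw [hq, div_mul_cancel₀ _ h0]
      ring
    · rw [(Ad_AN_entries t q ξ').2]
      change nilCoord b η = _ * nilCoord b ξ
      rw [ht, mul_neg, neg_neg, mul_div_cancel₀ _ two_ne_zero, Real.exp_log hpos,
        div_mul_cancel₀ _ h0]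
  rw [← Ad_twist_conj] at key
  have := congrArg (Ad (twist b)) key
  rwa [Ad_twist_Ad_twist_inv, Ad_twist_Ad_twist_inv] at this

theorem eq_one_of_Ad_eq {b : Bool} {r : SL2Cover} (hr : r ∈ neutral b)
    {ξ : Matrix (Fin 2) (Fin 2) ℝ} (h0 : nilCoord b ξ ≠ 0) (h : Ad r ξ = ξ) : r = 1 := by
  obtain ⟨t, q, rfl⟩ := mem_neutral.1 hr
  have h1 := Ad_twist_conj b (cartan t * unip q) ξ
  rw [h] at h1
  have h2 := (Ad_AN_entries t q (Ad (twist b)⁻¹ ξ)).1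
  have h3 := (Ad_AN_entries t q (Ad (twist b)⁻¹ ξ)).2
  rw [← h1] at h2 h3
  change nilCoord b ξ = _ * nilCoord b ξ at h3
  have hq : q = 0 := by
    have : q * nilCoord b ξ = 0 := by
      change _ = _ + q * nilCoord b ξ at h2
      linarith
    exact (mul_eq_zero.1 this).resolve_right h0
  have ht : t = 0 := by
    have := Real.exp_eq_one_iff _ |>.1 ((mul_eq_right₀ h0).1 h3.symm)
    linarith
  simp [hq, ht]

theorem lowerUnip_11 (s : ℝ) : (lowerUnip s).mat 1 1 = 1 := by
  simp only [lowerUnip, mul_entry]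
  simp

/-- No orbit on the wall is open. There `ξ' 0 0` is `1` or `-1`, and applying `lowerUnip s` gives
lower left entry `2 s ξ'₀₀ - s² ξ'₀₁`, which is nonzero for suitable arbitrarily small `s`. -/
theorem exists_nilCoord_ne_zero {b : Bool} {ξ : Matrix (Fin 2) (Fin 2) ℝ}
    (hξ : ξ ∈ adjointOrbit) (h0 : nilCoord b ξ = 0) {V : Set (Matrix (Fin 2) (Fin 2) ℝ)}
    (hV : IsOpen V) (hξV : ξ ∈ V) : ∃ η ∈ V ∩ adjointOrbit, nilCoord b η ≠ 0 := by
  by_contra! hn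
  set ξ' := Ad (twist b)⁻¹ ξ with hξ'
  have h1 : ξ' 0 0 * ξ' 0 0 = 1 := by
    have := (adjointOrbit_entries (Ad_mem_adjointOrbit (twist b)⁻¹ hξ)).2
    change ξ' 0 0 * ξ' 0 0 + ξ' 0 1 * nilCoord b ξ = 1 at this
    rwa [h0, mul_zero, add_zero] at this
  have hl : Continuous lowerUnip :=
    (continuous_const.mul (continuous_unip.comp continuous_neg)).mul continuous_const
  have hc : Continuous fun s => Ad (twist b * lowerUnip s * (twist b)⁻¹) ξ :=
    (continuous_Ad ξ).comp ((continuous_const.mul hl).mul continuous_const)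
  have hnhds : {s | Ad (twist b * lowerUnip s * (twist b)⁻¹) ξ ∈ V} ∈ 𝓝 (0 : ℝ) :=
    hc.continuousAt.preimage_mem_nhds (by
      have : lowerUnip 0 = 1 := by simp [lowerUnip]
      rw [this, mul_one, mul_inv_cancel, Ad_one]
      exact hV.mem_nhds hξV)
  obtain ⟨ε, hε, hball⟩ := Metric.mem_nhds_iff.1 hnhds
  have key : ∀ s, 0 < s → s < ε → 2 * ξ' 0 0 = s * ξ' 0 1 := fun s hs hsε => by
    have hm := hn _ ⟨hball (by rwa [Metric.mem_ball, Real.dist_eq, sub_zero, abs_of_pos hs]),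
      Ad_mem_adjointOrbit _ hξ⟩
    rw [nilCoord, Ad_twist_conj, ← hξ', (Ad_entries _ _).2.2.1, lowerUnip_10,
      lowerUnip_11] at hm
    have h10 : ξ' 1 0 = 0 := h0
    have h11 : ξ' 1 1 = -ξ' 0 0 :=
      (adjointOrbit_entries (Ad_mem_adjointOrbit (twist b)⁻¹ hξ)).1
    rw [h10, h11] at hm
    have : s * (2 * ξ' 0 0 - s * ξ' 0 1) = 0 := by linarith
    have := (mul_eq_zero.1 this).resolve_left hs.ne'
    linarith
  -- Two different values of `s` in the same linear relation force `ξ' 0 0 = 0`.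
  have k1 := key (ε / 2) (by linarith) (by linarith)
  have k2 := key (ε / 4) (by linarith) (by linarith)
  have : ξ' 0 0 = 0 := by linarith
  simp [this] at h1

/-- The part of the adjoint orbit where the coordinate `nilCoord b` has the sign of `ε`. -/
def halfOrbit (b : Bool) (ε : ℝ) : Set (Matrix (Fin 2) (Fin 2) ℝ) :=
  {ξ ∈ adjointOrbit | 0 < ε * nilCoord b ξ}

theorem orbit_eq_halfOrbit {b : Bool} {ε : ℝ} {ξ : Matrix (Fin 2) (Fin 2) ℝ}
    (hξ : ξ ∈ halfOrbit b ε) : {η | ∃ r ∈ neutral b, η = Ad r ξ} = halfOrbit b ε := by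
  ext η
  constructor
  · rintro ⟨r, hr, rfl⟩
    obtain ⟨c, hc, h⟩ := nilCoord_Ad_neutral hr ξ
    refine ⟨Ad_mem_adjointOrbit r hξ.1, ?_⟩
    rw [h, mul_left_comm]
    exact mul_pos hc hξ.2
  · rintro ⟨hη, h⟩
    refine exists_neutral_Ad_eq hξ.1 hη ?_
    have h1 := mul_pos hξ.2 h
    rw [mul_mul_mul_comm] at h1
    exact pos_of_mul_pos_right h1 (mul_self_nonneg ε)

theorem halfOrbit_nonempty (b : Bool) {ε : ℝ} (hε : ε ≠ 0) : (halfOrbit b ε).Nonempty := by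
  refine ⟨Ad (twist b) (Ad (weyl * unip ε) H), Ad_mem_adjointOrbit _ ⟨_, rfl⟩, ?_⟩
  rw [nilCoord_Ad_twist, (Ad_H_entries _).2.2.1, mul_entry, mul_entry]
  simp only [weyl_10, weyl_11, unip_00, unip_01, unip_10, unip_11]
  have := mul_self_pos.2 hε
  nlinarith

theorem openOrbits_eq (b : Bool) : openOrbits b = {halfOrbit b 1, halfOrbit b (-1)} := by
  have hopen : ∀ ε : ℝ, ε ≠ 0 → halfOrbit b ε ∈ openOrbits b := fun ε hε => by
    obtain ⟨ξ, hξ⟩ := halfOrbit_nonempty b hε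
    refine ⟨⟨ξ, hξ.1, (orbit_eq_halfOrbit hξ).symm⟩, {ξ | 0 < ε * nilCoord b ξ},
      isOpen_lt continuous_const (continuous_const.mul (continuous_nilCoord b)), ?_⟩
    ext η
    exact and_comm
  ext S
  constructor
  · rintro ⟨⟨ξ, hξ, rfl⟩, V, hV, hS⟩
    have hξS : ξ ∈ V ∩ adjointOrbit := by
      rw [← hS]
      exact ⟨1, one_mem _, (Ad_one ξ).symm⟩
    rcases lt_trichotomy (nilCoord b ξ) 0 with h | h | h
    · exact Or.inr (orbit_eq_halfOrbit ⟨hξ, by linarith⟩)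
    · obtain ⟨η, hη, hη0⟩ := exists_nilCoord_ne_zero hξ h hV hξS.1
      rw [← hS] at hη
      obtain ⟨r, hr, rfl⟩ := hη
      obtain ⟨c, -, hc⟩ := nilCoord_Ad_neutral hr ξ
      rw [hc, h, mul_zero] at hη0
      exact absurd rfl hη0
    · exact Or.inl (orbit_eq_halfOrbit ⟨hξ, by linarith⟩)
  · rintro (rfl | rfl)
    · exact hopen 1 one_ne_zero
    · exact hopen (-1) (by norm_num)

theorem ncard_openOrbits (b : Bool) : (openOrbits b).ncard = 2 := by
  rw [openOrbits_eq, ncard_pair]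
  intro h
  obtain ⟨ξ, hξ⟩ := halfOrbit_nonempty b one_ne_zero
  have h1 := hξ.2
  rw [h] at hξ
  have h2 := hξ.2
  linarith

theorem mem_complementNilPerp {b : Bool} {ξ : Matrix (Fin 2) (Fin 2) ℝ} :
    ξ ∈ complementNilPerp b ↔ ξ ∈ adjointOrbit ∧ nilCoord b ξ ≠ 0 := by
  refine and_congr_right fun _ => ?_
  cases b
  · rw [nilCoord_false, killing, Matrix.trace_fin_two, Matrix.mul_apply, Matrix.mul_apply]
    simp
  · rw [nilCoord_true, killing, Matrix.trace_fin_two, Matrix.mul_apply, Matrix.mul_apply]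
    simp

theorem _root_.IsPreconnected.mul_pos {X : Type*} [TopologicalSpace X] {T : Set X}
    (hT : IsPreconnected T) {f : X → ℝ} (hf : ContinuousOn f T) (h0 : ∀ x ∈ T, f x ≠ 0) {x y : X}
    (hx : x ∈ T) (hy : y ∈ T) : 0 < f x * f y := by
  have hord := (hT.image f hf).ordConnected
  by_contra! hle
  have h : (0 : ℝ) ∈ f '' T := by
    rcases mul_nonpos_iff.1 hle with h | h
    · exact hord.out (mem_image_of_mem f hy) (mem_image_of_mem f hx) ⟨h.2, h.1⟩
    · exact hord.out (mem_image_of_mem f hx) (mem_image_of_mem f hy) h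
  obtain ⟨z, hz, hz0⟩ := h
  exact h0 z hz hz0

theorem isPreconnected_neutral (b : Bool) : IsPreconnected (neutral b : Set SL2Cover) := by
  rw [coe_neutral]
  exact isPreconnected_connectedComponentIn

/-- A half orbit is connected as an orbit of the connected group `neutral b`, and `nilCoord b` has
constant sign on a connected subset of the complement of the wall. -/
theorem connectedComponentIn_complementNilPerp {b : Bool} {ε : ℝ}
    {ξ : Matrix (Fin 2) (Fin 2) ℝ} (hξ : ξ ∈ halfOrbit b ε) :
    connectedComponentIn (complementNilPerp b) ξ = halfOrbit b ε := by
  have hsub : halfOrbit b ε ⊆ complementNilPerp b := fun η hη =>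
    mem_complementNilPerp.2 ⟨hη.1, right_ne_zero_of_mul hη.2.ne'⟩
  refine Subset.antisymm (fun η hη => ?_) ?_
  · have h1 := isPreconnected_connectedComponentIn.mul_pos (continuous_nilCoord b).continuousOn
      (fun ζ hζ => (mem_complementNilPerp.1 (connectedComponentIn_subset _ _ hζ)).2)
      (mem_connectedComponentIn (hsub hξ)) hη
    rw [← orbit_eq_halfOrbit hξ]
    exact exists_neutral_Ad_eq hξ.1
      (mem_complementNilPerp.1 (connectedComponentIn_subset _ _ hη)).1 h1
  · refine IsPreconnected.subset_connectedComponentIn ?_ hξ hsub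
    rw [← orbit_eq_halfOrbit hξ]
    convert (isPreconnected_neutral b).image (fun r => Ad r ξ) (continuous_Ad ξ).continuousOn using 1
    ext η
    simp only [mem_image, eq_comm]
    rfl

theorem openOrbits_eq_components (b : Bool) : openOrbits b =
    {C | ∃ ξ ∈ complementNilPerp b, C = connectedComponentIn (complementNilPerp b) ξ} := by
  rw [openOrbits_eq]
  have hmem : ∀ ε : ℝ, ε ≠ 0 → ∃ ξ ∈ complementNilPerp b,
      halfOrbit b ε = connectedComponentIn (complementNilPerp b) ξ := fun ε hε => by
    obtain ⟨ξ, hξ⟩ := halfOrbit_nonempty b hε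
    exact ⟨ξ, mem_complementNilPerp.2 ⟨hξ.1, right_ne_zero_of_mul hξ.2.ne'⟩,
      (connectedComponentIn_complementNilPerp hξ).symm⟩
  ext C
  constructor
  · rintro (rfl | rfl)
    · exact hmem 1 one_ne_zero
    · exact hmem (-1) (by norm_num)
  · rintro ⟨ξ, hξ, rfl⟩
    obtain ⟨hξ, h0⟩ := mem_complementNilPerp.1 hξ
    rcases lt_or_gt_of_ne h0 with h | h
    · exact Or.inr (connectedComponentIn_complementNilPerp ⟨hξ, by linarith⟩)
    · exact Or.inl (connectedComponentIn_complementNilPerp ⟨hξ, by linarith⟩)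

theorem nilCoord_Ad_cartan (b : Bool) (t : ℝ) (ξ : Matrix (Fin 2) (Fin 2) ℝ) :
    nilCoord b (Ad (cartan t) ξ) = Real.exp ((if b then -2 else 2) * t) * nilCoord b ξ := by
  cases b
  · rw [nilCoord_false, nilCoord_false, (Ad_entries _ _).2.1]
    simp
    rw [mul_right_comm, ← Real.exp_add, two_mul]
  · have := (Ad_AN_entries t 0 ξ).2
    rw [unip_zero, mul_one] at this
    simp [nilCoord_true, this]

theorem actsProperlyDiscontinuously_halfOrbit (D : KillingDatum) (b : Bool) (ε : ℝ) :
    ActsProperlyDiscontinuously (fun (n : ℤ) ξ => Ad (cartan (D.m * n)) ξ) (halfOrbit b ε) := by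
  have h0 : ∀ ξ ∈ halfOrbit b ε, nilCoord b ξ ≠ 0 := fun ξ hξ => right_ne_zero_of_mul hξ.2.ne'
  refine actsProperlyDiscontinuously_of_displacement (F := fun ξ => Real.log (nilCoord b ξ))
    (mul_pos two_pos D.m_pos) ((continuous_nilCoord b).continuousOn.log h0) fun n ξ hξ => ?_
  rw [nilCoord_Ad_cartan, Real.log_mul (Real.exp_ne_zero _) (h0 ξ hξ), Real.log_exp,
    add_sub_cancel_right, abs_mul, abs_mul, abs_of_pos D.m_pos, mul_assoc]
  cases b <;> simp

/-! ### The twisted conjugacy classes of the Cartan subgroup -/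

/-- Up to a sign, the off-diagonal entries of `τ_k (a)` are those of `Ad k H` scaled by `cosh t >
0`. This links the sheets of `G` to the sides of the wall in the adjoint orbit. -/
theorem tau_cartan_entries (k : SL2Cover) (t : ℝ) :
    (tau k (cartan t)).mat 0 0 =
        k.mat 0 0 * k.mat 1 1 * Real.exp t + k.mat 0 1 * k.mat 1 0 * Real.exp (-t) ∧
      (tau k (cartan t)).mat 0 1 = -(Real.cosh t * Ad k H 0 1) ∧
      (tau k (cartan t)).mat 1 0 = Real.cosh t * Ad k H 1 0 ∧
      (tau k (cartan t)).mat 1 1 =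
        k.mat 0 1 * k.mat 1 0 * Real.exp t + k.mat 0 0 * k.mat 1 1 * Real.exp (-t) := by
  rw [(Ad_H_entries k).2.1, (Ad_H_entries k).2.2.1, Real.cosh_eq, tau, map_inv]
  simp only [mul_entry]
  simp
  refine ⟨?_, ?_, ?_, ?_⟩ <;> ring

/-- If `u` and `w` are the entries `00` and `10` of `Ad k H`, then `τ_k (cartan t)` has diagonal
entries `u cosh t ± sinh t` and lower left entry `w cosh t`. These equations are solved for `t`,
`u`, `w`; here `w ≠ 0` because `c ≠ 0`. -/
theorem exists_eq_tau_cartan {x : SL2Cover} (hx : x.mat 1 0 ≠ 0) :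
    ∃ t k, x = tau k (cartan t) := by
  set t := Real.arsinh ((x.mat 0 0 - x.mat 1 1) / 2) with ht
  have hsinh : Real.sinh t = (x.mat 0 0 - x.mat 1 1) / 2 := Real.sinh_arsinh _
  have hcosh := Real.cosh_pos t
  set u := (x.mat 0 0 + x.mat 1 1) / (2 * Real.cosh t) with hu
  set w := x.mat 1 0 / Real.cosh t with hw
  have hu' : u * Real.cosh t = (x.mat 0 0 + x.mat 1 1) / 2 := by
    rw [hu]
    field_simp
  have hw' : Real.cosh t * w = x.mat 1 0 := by
    rw [hw]
    field_simp
  have hw0 : w ≠ 0 := div_ne_zero hx hcosh.ne'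
  have hbc : (u - 1) / (2 * w) * w = (u - 1) / 2 := by field_simp
  -- A matrix of determinant `1` with `Ad k H 0 0 = u` and `Ad k H 1 0 = w`; the right factor in
  -- `A`, which does not change `Ad k H`, is normalized by `k₁₁ = 1 / 2`.
  obtain ⟨k, hk⟩ := surjective_mat ⟨!![u + 1, (u - 1) / (2 * w); w, 1 / 2], by
    rw [Matrix.det_fin_two]
    simp only [Matrix.of_apply, Matrix.cons_val', Matrix.cons_val_zero, Matrix.cons_val_one,
      Matrix.cons_val_fin_one]
    rw [hbc]
    ring⟩
  have k00 : k.mat 0 0 = u + 1 := by simp [hk]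
  have k01 : k.mat 0 1 = (u - 1) / (2 * w) := by simp [hk]
  have k10 : k.mat 1 0 = w := by simp [hk]
  have k11 : k.mat 1 1 = 1 / 2 := by simp [hk]
  obtain ⟨h00, -, h10, h11⟩ := tau_cartan_entries k t
  rw [(Ad_H_entries k).2.2.1] at h10
  rw [k00, k01, k10, k11, hbc] at h00 h11
  rw [k10, k11] at h10
  rw [Real.sinh_eq] at hsinh
  rw [Real.cosh_eq] at hu'
  have e00 : x.mat 0 0 = (tau k (cartan t)).mat 0 0 := by linarith
  have e11 : x.mat 1 1 = (tau k (cartan t)).mat 1 1 := by linarith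
  have e10 : x.mat 1 0 = (tau k (cartan t)).mat 1 0 := by
    rw [h10, ← hw']
    ring
  have hmat : x.mat = (tau k (cartan t)).mat := by
    refine mat_eq_of_entries e00 ?_ e10 e11
    have d1 := det_entries x
    have d2 := det_entries (tau k (cartan t))
    rw [← e00, ← e10, ← e11] at d2
    apply mul_right_cancel₀ hx
    linarith
  obtain ⟨i, hi⟩ := exists_center_zpow_mul_of_mat_eq hmat
  -- The matrices agree, so the lifts differ by an even power of `centerGen`, which is what
  -- replacing `k` by `centerGen ^ i * k` produces.
  refine ⟨t, centerGen ^ i * k, ?_⟩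
  have hc := (commute_center_zpow i (k * cartan t * sigma k⁻¹)).eq
  rw [hi, tau, tau, mul_inv_rev, map_mul, map_inv sigma (centerGen ^ i), sigma_center_zpow, inv_inv,
    two_mul, zpow_add, mul_assoc (centerGen ^ i), hc]
  simp only [mul_assoc]

theorem exists_twist_conj_eq_tau_cartan (b : Bool) {x : SL2Cover} (hx : x.mat 1 0 ≠ 0) :
    ∃ t k, twist b * x * (twist b)⁻¹ = tau k (cartan t) := by
  obtain ⟨t, k, rfl⟩ := exists_eq_tau_cartan hx
  cases b
  · refine ⟨-t, weyl * k * weyl⁻¹, ?_⟩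
    have h := cartan_mul_weyl (-t)
    rw [neg_neg, ← eq_mul_inv_iff_mul_eq] at h
    rw [h, tau_weyl_conj, twist_false]
  · exact ⟨t, k, by simp⟩

theorem tau_cartan_nilCoord {b : Bool} {k x : SL2Cover} {t : ℝ}
    (h : twist b * x * (twist b)⁻¹ = tau k (cartan t)) :
    x.mat 1 0 = (if b then 1 else -1) * (Real.cosh t * nilCoord b (Ad k H)) := by
  obtain ⟨-, h01, h10, -⟩ := tau_cartan_entries k t
  rw [← h] at h01 h10
  cases b
  · rw [twist_false, (weyl_conj_entries x).2.1] at h01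
    rw [nilCoord_false]
    simp
    linarith
  · simpa [nilCoord_true] using h10

/-- By `tau_cartan_nilCoord` the entry `c` in the normal form and `nilCoord b (Ad k H)` differ by
the factor `cosh t`, with a sign for `b = false`. Every point with `c ≠ 0` is reached, so the
preimage is a half of the set `c ≠ 0`, a union of sheets. -/
theorem orbitPreimage_halfOrbit (D : KillingDatum) (b : Bool) (ε : ℝ) :
    orbitPreimage D (halfOrbit b ε) =
      adapted D b '' {x | 0 < (if b then ε else -ε) * x.mat 1 0} := by
  have key : ∀ {x k t}, twist b * x * (twist b)⁻¹ = tau k (cartan t) →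
      (0 < (if b then ε else -ε) * x.mat 1 0 ↔ 0 < ε * nilCoord b (Ad k H)) := by
    intro x k t h
    have h1 : (if b then ε else -ε) * x.mat 1 0 =
        Real.cosh t * (ε * nilCoord b (Ad k H)) := by
      rw [tau_cartan_nilCoord h]
      cases b <;> simp <;> ring
    rw [h1]
    exact mul_pos_iff_of_pos_left (Real.cosh_pos t)
  ext y
  constructor
  · rintro ⟨t, k, rfl, hk⟩
    have h : twist b * ((twist b)⁻¹ * tau k (cartan t) * twist b) * (twist b)⁻¹ =
        tau k (cartan t) := by group
    refine ⟨(twist b)⁻¹ * tau k (cartan t) * twist b, (key h).2 hk.2, ?_⟩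
    rw [adapted_apply, h]
  · rintro ⟨x, hx, rfl⟩
    obtain ⟨t, k, h⟩ := exists_twist_conj_eq_tau_cartan b
      (right_ne_zero_of_mul (ne_of_gt hx))
    exact ⟨t, k, by rw [adapted_apply, h], ⟨k, rfl⟩, (key h).1 hx⟩

theorem connectedComponentIn_entry_10_pos {ε : ℝ} {x : SL2Cover} {j : ℤ}
    (hx : 0 < ε * x.mat 1 0) (hj : x ∈ sheet j) :
    connectedComponentIn {x : SL2Cover | 0 < ε * x.mat 1 0} x = sheet j := by
  refine Subset.antisymm ?_ ?_
  · refine isPreconnected_connectedComponentIn.subset_sheet (fun y hy => ?_)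
      (mem_connectedComponentIn hx) hj
    have h : y ∈ {x : SL2Cover | 0 < ε * x.mat 1 0} := connectedComponentIn_subset _ _ hy
    exact right_ne_zero_of_mul (ne_of_gt h)
  · refine IsPreconnected.subset_connectedComponentIn
      (isSimplyConnected_sheet j).isPathConnected.isConnected.isPreconnected hj fun y hy => ?_
    have h1 := mul_pos hx (entry_10_mul_pos_of_mem_sheet hj hy)
    have h2 : ε * x.mat 1 0 * (x.mat 1 0 * y.mat 1 0) =
        (x.mat 1 0 * x.mat 1 0) * (ε * y.mat 1 0) := by ring
    rw [h2] at h1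
    exact pos_of_mul_pos_right h1 (mul_self_nonneg _)

theorem exists_component_orbitPreimage_eq (D : KillingDatum) (b : Bool) (ε : ℝ) {x : SL2Cover}
    (hx : x ∈ orbitPreimage D (halfOrbit b ε)) :
    ∃ j, connectedComponentIn (orbitPreimage D (halfOrbit b ε)) x = adapted D b '' sheet j := by
  rw [orbitPreimage_halfOrbit] at hx ⊢
  obtain ⟨x, hx, rfl⟩ := hx
  obtain ⟨j, hj⟩ := exists_mem_sheet (right_ne_zero_of_mul (ne_of_gt hx))
  exact ⟨j, by rw [← Homeomorph.image_connectedComponentIn _ hx,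
    connectedComponentIn_entry_10_pos hx hj]⟩

theorem exists_eq_halfOrbit {b : Bool} {S : Set (Matrix (Fin 2) (Fin 2) ℝ)}
    (hS : S ∈ openOrbits b) : ∃ ε, S = halfOrbit b ε := by
  rw [openOrbits_eq] at hS
  rcases hS with h | h
  · exact ⟨_, h⟩
  · exact ⟨_, h⟩

end BHTZ

/-! ### The main theorem. -/

theorem mainTheorem1 (D : BHTZ.KillingDatum) :
    (∀ U : Set SL2Cover, BHTZ.IsBHTZDomain D U →
      (∀ b : Bool, ∃! E : Set SL2Cover,
        BHTZ.IsExtensionDomain D E ∧ U ⊆ E ∧ BHTZ.FoliatedByOrbits D b E) ∧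
      ∀ (b b' : Bool) (E E' : Set SL2Cover),
        BHTZ.IsExtensionDomain D E → U ⊆ E → BHTZ.FoliatedByOrbits D b E →
        BHTZ.IsExtensionDomain D E' → U ⊆ E' → BHTZ.FoliatedByOrbits D b' E' →
        BHTZ.ConjugateOver D U E E') ∧
    (D.m = D.m' → ∀ b : Bool,
      (BHTZ.openOrbits b).ncard = 2 ∧
      BHTZ.openOrbits b = {C | ∃ ξ ∈ BHTZ.complementNilPerp b,
        C = connectedComponentIn (BHTZ.complementNilPerp b) ξ} ∧
      ∀ S ∈ BHTZ.openOrbits b,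
        (∀ ξ ∈ S, ∀ r ∈ BHTZ.neutral b, BHTZ.Ad r ξ = ξ → r = 1) ∧
        BHTZ.ActsProperlyDiscontinuously
          (fun (n : ℤ) ξ => BHTZ.Ad (SL2Cover.cartan (D.m * n)) ξ) S ∧
        ∀ x ∈ BHTZ.orbitPreimage D S,
          BHTZ.IsExtensionDomain D (connectedComponentIn (BHTZ.orbitPreimage D S) x) ∧
          BHTZ.FoliatedByOrbits D b (connectedComponentIn (BHTZ.orbitPreimage D S) x)) := by
  refine ⟨fun U hU => ⟨BHTZ.existsUnique_extensionDomain hU,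
    fun b b' E E' hE hUE hf hE' hUE' hf' =>
      BHTZ.conjugateOver_of_foliatedByOrbits hU hE hUE hf hE' hUE' hf'⟩,
    fun hD b => ⟨BHTZ.ncard_openOrbits b, BHTZ.openOrbits_eq_components b, fun S hS => ?_⟩⟩
  obtain ⟨ε, rfl⟩ := BHTZ.exists_eq_halfOrbit hS
  refine ⟨fun ξ hξ r hr h => BHTZ.eq_one_of_Ad_eq hr (right_ne_zero_of_mul (ne_of_gt hξ.2)) h,
    BHTZ.actsProperlyDiscontinuously_halfOrbit D b ε, fun x hx => ?_⟩
  obtain ⟨j, hj⟩ := BHTZ.exists_component_orbitPreimage_eq D b ε hx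
  rw [hj]
  exact ⟨(BHTZ.isExtensionDomain_sheet hD j).image (BHTZ.adapted_intertwines D b),
    (BHTZ.foliatedByOrbits_adapted_iff D b _).2 (BHTZ.foliatedByOrbits_sheet hD j)⟩
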